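/- There is a universal constant $a>0$ such that the following holds. Let $\mathsf X$ be a finite set, $B_0:\mathsf X\to\mathbb R$ a non-zero function, $B:\mathsf X\times\mathsf X\to\mathbb R$ a non-zero symmetric function, and $p,T\ge 1$ integers. For a real symmetric $p\times p$ matrix $\theta$ let $g_\theta(x)\propto\exp\big(\sum_j\theta_{jj}B_0(x_j)+\sum_{k<j}\theta_{jk}B(x_j,x_k)\big)$, $x\in\mathsf X^p$, let $\mathbb E_\theta$ be the expectation under $X\sim g_\theta$, let $f^{(j)}_\theta(u\mid x)$ be the conditional probability under $g_\theta$ of $X_j=u$ given $X_{-j}=x_{-j}$, and let $\phi(\theta,x)=-\sum_j\log f_\theta^{(j)}(x_j\mid x)$. Symmetric matrices are identified with vectors in $\mathbb R^d$, $d=p(p+1)/2$, through the entries $\theta_{jk}$, $k\le j$; $\|\cdot\|_1,\|\cdot\|_2$, supports and numbers of non-zero components refer to these $d$ coordinates. Put $c_0=\max\big(\sup_{u,v}|B_0(u)-B_0(v)|,\ \sup_{x,u,v}|B(x,u)-B(x,v)|\big)$. Let $\alpha_\star\in(0,1)$, $\tau_\star=\lceil\alpha_\star T\rceil\in\{1,\dots,T-1\}$,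 and let $\theta_\star^{(1)},\theta_\star^{(2)}$ be symmetric with $s_1,s_2$ non-zero components. Let $X^{(1)},\dots,X^{(T)}$ be independent, with law $g_{\theta_\star^{(1)}}$ for $t\le\tau_\star$ and $g_{\theta_\star^{(2)}}$ for $t>\tau_\star$. Assume: (H1) for $j=1,2$, with $\mathcal A_j$ the support of $\theta_\star^{(j)}$, $\rho_j>0$ is such that $\sum_{i}\mathbb E_{\theta_\star^{(j)}}\big[\mathrm{Var}_{\theta_\star^{(j)}}\big(\sum_k\Delta_{ik}B_{ik}(X_i,X_k)\mid X_{-i}\big)\big]\ge 2\rho_j\|\Delta\|_2^2$ for every symmetric $\Delta$ with $\sum_{\mathcal A_j^c}|\Delta_{ik}|\le 3\sum_{\mathcal A_j}|\Delta_{ik}|$, where $B_{ii}(x,y)=B_0(x)$ and $B_{ik}=B$ for $i\ne k$; (H2) $\min\Big(\frac{T}{2^{11}\log(pT)},\frac{T}{48^2\cdot 32^2\log(dT)}\Big)\ge c_0^2\max\Big(\frac{s_1^2}{\alpha_\star\rho_1^2},\frac{s_2^2}{(1-\alpha_\star)\rho_2^2}\Big)$; (H3) $\theta_\star^{(1)}\ne\theta_\star^{(2)}$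 and $\kappa:=\min\big(\mathbb E_{\theta_\star^{(2)}}[\phi(\theta_\star^{(1)},X)-\phi(\theta_\star^{(2)},X)],\ \mathbb E_{\theta_\star^{(1)}}[\phi(\theta_\star^{(2)},X)-\phi(\theta_\star^{(1)},X)]\big)>0$. Let $b=\sup_j\sum_k|\theta^{(2)}_{\star jk}-\theta^{(1)}_{\star jk}|$ and let $\mathcal T\subseteq\{1,\dots,T\}$ be a search domain containing $\tau_\star$ such that: every $\tau\in\mathcal T$ with $\tau>\tau_\star$ satisfies $c_0b(\tau-\tau_\star)\le2\sqrt{\tau\log(dT)}$ and $64c_0^3bs_1(\tau-\tau_\star)\le\rho_1\tau$; every $\tau\in\mathcal T$ with $\tau\le\tau_\star$ satisfies $c_0b(\tau_\star-\tau)\le2\sqrt{(T-\tau)\log(dT)}$ and $64c_0^3bs_2(\tau_\star-\tau)\le\rho_2(T-\tau)$; and every $\tau\in\mathcal T$ satisfies $\tau\ge K(s_1/\rho_1)^2\log(dT)$ and $T-\tau\ge K(s_2/\rho_2)^2\log(dT)$ with $K=\max(2^{11},(48\cdot32)^2)\,c_0^4$. For $\tau\in\mathcal T$ let $\hat\theta_{1,\tau}$,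 $\hat\theta_{2,\tau}$ be any minimizers over symmetric $\theta$ of $\frac1T\sum_{t\le\tau}\phi(\theta,X^{(t)})+\lambda_{1,\tau}\|\theta\|_1$ and $\frac1T\sum_{\tau<t\le T}\phi(\theta,X^{(t)})+\lambda_{2,\tau}\|\theta\|_1$, where $\lambda_{1,\tau}=32c_0\sqrt{\tau\log(dT)}/T$ and $\lambda_{2,\tau}=32c_0\sqrt{(T-\tau)\log(dT)}/T$, and let $\hat\tau$ be any minimizer over $\tau\in\mathcal T$ of $\frac1T\sum_{t\le\tau}\phi(\hat\theta_{1,\tau},X^{(t)})+\frac1T\sum_{\tau<t\le T}\phi(\hat\theta_{2,\tau},X^{(t)})$. Put $M=\frac{s_1}{\rho_1}\big(1+c_0\frac{s_1}{\rho_1}\big)+\frac{s_2}{\rho_2}\big(1+c_0\frac{s_2}{\rho_2}\big)$, $\delta=aMc_0^2\log(dT)$, and let $s$ be the number of non-zero components of $\theta_\star^{(2)}-\theta_\star^{(1)}$. Then $$\mathbb P\Big(\Big|\frac{\hat\tau}{T}-\alpha_\star\Big|>\frac{4\delta}{\kappa T}\Big)\le\frac{16}{d}+\frac{4\exp\Big(-\frac{\delta}{32c_0^2s}\,\frac{\kappa}{\|\theta_\star^{(2)}-\theta_\star^{(1)}\|_2^2}\Big)}{1-\exp\Big(-\frac{\kappa^2}{2^7c_0^2s\|\theta_\star^{(2)}-\theta_\star^{(1)}\|_2^2}\Big)}.$$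 -/

import Mathlib

open MeasureTheory ProbabilityTheory

namespace MRFChangePoint

noncomputable section

/-! ### Symmetric matrices as vectors with `d = p (p + 1) / 2` coordinates -/

section Matrices

variable {p : ℕ}

/-- The index set `{(j, k) : k ≤ j}` of the free coordinates of a symmetric matrix. -/
def coords (p : ℕ) : Finset (Fin p × Fin p) :=
  Finset.univ.filter fun e => e.2 ≤ e.1

/-- The number `d = p (p + 1) / 2` of free coordinates, as a real number. -/
def dimn (p : ℕ) : ℝ := (p : ℝ) * ((p : ℝ) + 1) / 2

/-- `‖θ‖₁ = ∑_{k ≤ j} |θ_jk|`. -/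
def normOne (θ : Matrix (Fin p) (Fin p) ℝ) : ℝ :=
  ∑ e ∈ coords p, |θ e.1 e.2|

/-- `‖θ‖₂² = ∑_{k ≤ j} θ_jk²`. -/
def normTwoSq (θ : Matrix (Fin p) (Fin p) ℝ) : ℝ :=
  ∑ e ∈ coords p, θ e.1 e.2 ^ 2

/-- The support `{(j, k) : k ≤ j, θ_jk ≠ 0}`. -/
def supp (θ : Matrix (Fin p) (Fin p) ℝ) : Finset (Fin p × Fin p) :=
  (coords p).filter fun e => θ e.1 e.2 ≠ 0

/-- The number of non-zero coordinates of `θ`. -/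
def sparsity (θ : Matrix (Fin p) (Fin p) ℝ) : ℕ := (supp θ).card

/-- The cone of the symmetric matrices whose `ℓ¹`-mass off the support of `θ` is at most three
times their `ℓ¹`-mass on the support of `θ`. -/
def cone (θ : Matrix (Fin p) (Fin p) ℝ) : Set (Matrix (Fin p) (Fin p) ℝ) :=
  {Δ | Δ.IsSymm ∧
    ∑ e ∈ coords p \ supp θ, |Δ e.1 e.2| ≤ 3 * ∑ e ∈ supp θ, |Δ e.1 e.2|}

/-- `b = sup_j ∑_k |θ₂_jk - θ₁_jk|`. -/
def rowGap (θ₁ θ₂ : Matrix (Fin p) (Fin p) ℝ) : ℝ :=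
  ⨆ j : Fin p, ∑ k : Fin p, |θ₂ j k - θ₁ j k|

end Matrices

/-! ### The Markov random field and its pseudo-likelihood -/

section Model

variable {p : ℕ} {𝒳 : Type*} [Fintype 𝒳]

/-- The exponent `∑_j θ_jj B₀(x_j) + ∑_{k < j} θ_jk B(x_j, x_k)`. -/
def energy (B₀ : 𝒳 → ℝ) (B : 𝒳 → 𝒳 → ℝ) (θ : Matrix (Fin p) (Fin p) ℝ) (x : Fin p → 𝒳) : ℝ :=
  ∑ j : Fin p, θ j j * B₀ (x j) +
    ∑ j : Fin p, ∑ k ∈ Finset.univ.filter (fun k : Fin p => k < j), θ j k * B (x j) (x k)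

/-- The probability mass function `g_θ`. -/
def mrf (B₀ : 𝒳 → ℝ) (B : 𝒳 → 𝒳 → ℝ) (θ : Matrix (Fin p) (Fin p) ℝ) (x : Fin p → 𝒳) : ℝ :=
  Real.exp (energy B₀ B θ x) / ∑ y : Fin p → 𝒳, Real.exp (energy B₀ B θ y)

/-- The expectation `E_θ[F(X)]`, `X ∼ g_θ`. -/
def expect (B₀ : 𝒳 → ℝ) (B : 𝒳 → 𝒳 → ℝ) (θ : Matrix (Fin p) (Fin p) ℝ)
    (F : (Fin p → 𝒳) → ℝ) : ℝ :=
  ∑ x : Fin p → 𝒳, mrf B₀ B θ x * F x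

/-- `B_ik(u, v)`, which is `B₀(u)` if `i = k` and `B(u, v)` otherwise. -/
def pairFun (B₀ : 𝒳 → ℝ) (B : 𝒳 → 𝒳 → ℝ) (i k : Fin p) (u v : 𝒳) : ℝ :=
  if i = k then B₀ u else B u v

/-- `∑_k θ_jk B_jk(u, x_k) = θ_jj B₀(u) + ∑_{k ≠ j} θ_jk B(u, x_k)`. -/
def localField (B₀ : 𝒳 → ℝ) (B : 𝒳 → 𝒳 → ℝ) (θ : Matrix (Fin p) (Fin p) ℝ) (j : Fin p)
    (u : 𝒳) (x : Fin p → 𝒳) : ℝ :=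
  ∑ k : Fin p, θ j k * pairFun B₀ B j k u (x k)

/-- The conditional probability `f_θ^{(j)}(u | x) = P_θ(X_j = u | X_{-j} = x_{-j})`; see
`condProb_eq` below. -/
def condProb (B₀ : 𝒳 → ℝ) (B : 𝒳 → 𝒳 → ℝ) (θ : Matrix (Fin p) (Fin p) ℝ) (j : Fin p)
    (u : 𝒳) (x : Fin p → 𝒳) : ℝ :=
  Real.exp (localField B₀ B θ j u x) / ∑ z : 𝒳, Real.exp (localField B₀ B θ j z x)

/-- The part of the exponent that does not involve the coordinate `j`. -/
def restEnergy (B₀ : 𝒳 → ℝ) (B : 𝒳 → 𝒳 → ℝ) (θ : Matrix (Fin p) (Fin p) ℝ) (j : Fin p)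
    (x : Fin p → 𝒳) : ℝ :=
  ∑ i : Fin p, (if i = j then 0 else θ i i * B₀ (x i)) +
    ∑ i : Fin p, ∑ k : Fin p,
      (if i = j ∨ k = j then 0 else if k < i then θ i k * B (x i) (x k) else 0)

lemma energy_split (B₀ : 𝒳 → ℝ) {B : 𝒳 → 𝒳 → ℝ} (hB : ∀ u v, B u v = B v u)
    {θ : Matrix (Fin p) (Fin p) ℝ} (hθ : θ.IsSymm) (j : Fin p) (x : Fin p → 𝒳) :
    energy B₀ B θ x = localField B₀ B θ j (x j) x + restEnergy B₀ B θ j x := by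
  classical
  have h1 : ∑ i : Fin p, θ i i * B₀ (x i)
      = θ j j * B₀ (x j) + ∑ i : Fin p, (if i = j then 0 else θ i i * B₀ (x i)) := by
    have : ∀ i : Fin p, θ i i * B₀ (x i)
        = (if i = j then θ j j * B₀ (x j) else 0)
          + (if i = j then 0 else θ i i * B₀ (x i)) := by
      intro i; split_ifs with h <;> simp [h]
    rw [Finset.sum_congr rfl fun i _ => this i, Finset.sum_add_distrib]
    simp
  have h2 : ∑ i : Fin p, ∑ k ∈ Finset.univ.filter (fun k : Fin p => k < i),
        θ i k * B (x i) (x k)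
      = ∑ k : Fin p, (if j = k then 0 else θ j k * B (x j) (x k))
        + ∑ i : Fin p, ∑ k : Fin p,
          (if i = j ∨ k = j then 0 else if k < i then θ i k * B (x i) (x k) else 0) := by
    have hterm : ∀ i k : Fin p, (if k < i then θ i k * B (x i) (x k) else 0)
        = ((if i = j then (if k < j then θ j k * B (x j) (x k) else 0) else 0)
          + (if k = j then (if j < i then θ j i * B (x j) (x i) else 0) else 0))
          + (if i = j ∨ k = j then 0 else if k < i then θ i k * B (x i) (x k) else 0) := by
      intro i k
      by_cases hi : i = j
      · subst hi
        by_cases hk : k = i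
        · subst hk; simp
        · simp [hk]
      · by_cases hk : k = j
        · subst hk
          simp [hi, hθ.apply k i, hB (x i) (x k)]
        · simp [hi, hk]
    simp only [Finset.sum_filter]
    rw [Finset.sum_congr rfl fun i _ => Finset.sum_congr rfl fun k _ => hterm i k]
    simp only [Finset.sum_add_distrib]
    congr 1
    rw [Finset.sum_comm]
    simp only [Finset.sum_ite_eq', Finset.mem_univ, if_true]
    rw [← Finset.sum_add_distrib]
    refine Finset.sum_congr rfl fun k _ => ?_
    rcases lt_trichotomy k j with h | h | h
    · simp [h, h.ne', h.not_gt]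
    · simp [h]
    · simp [h, h.ne, h.not_gt]
  have h3 : localField B₀ B θ j (x j) x
      = θ j j * B₀ (x j) + ∑ k : Fin p, (if j = k then 0 else θ j k * B (x j) (x k)) := by
    have : ∀ k : Fin p, θ j k * pairFun B₀ B j k (x j) (x k)
        = (if k = j then θ j j * B₀ (x j) else 0)
          + (if j = k then 0 else θ j k * B (x j) (x k)) := by
      intro k
      by_cases h : j = k
      · subst h; simp [pairFun]
      · simp [pairFun, h, Ne.symm h]
    unfold localField
    rw [Finset.sum_congr rfl fun k _ => this k, Finset.sum_add_distrib]
    simp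
  unfold energy restEnergy
  rw [h1, h2, h3]
  ring

/-- `condProb` is the conditional probability of `X_j = u` given the other coordinates. -/
theorem condProb_eq (B₀ : 𝒳 → ℝ) {B : 𝒳 → 𝒳 → ℝ} (hB : ∀ u v, B u v = B v u)
    {θ : Matrix (Fin p) (Fin p) ℝ} (hθ : θ.IsSymm) (j : Fin p) (u : 𝒳) (x : Fin p → 𝒳) :
    condProb B₀ B θ j u x
      = mrf B₀ B θ (Function.update x j u) / ∑ z : 𝒳, mrf B₀ B θ (Function.update x j z) := by
  classical
  have hrest : ∀ z, restEnergy B₀ B θ j (Function.update x j z) = restEnergy B₀ B θ j x := by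
    intro z
    unfold restEnergy
    congr 1
    · refine Finset.sum_congr rfl fun i _ => ?_
      split_ifs with h
      · rfl
      · rw [Function.update_of_ne h]
    · refine Finset.sum_congr rfl fun i _ => Finset.sum_congr rfl fun k _ => ?_
      split_ifs with h
      · rfl
      · rw [Function.update_of_ne fun e => h (Or.inl e),
          Function.update_of_ne fun e => h (Or.inr e)]
      · rfl
  have hloc : ∀ z, localField B₀ B θ j z (Function.update x j z) = localField B₀ B θ j z x := by
    intro z
    refine Finset.sum_congr rfl fun k _ => ?_
    by_cases h : j = k
    · simp [pairFun, h]
    · rw [Function.update_of_ne (Ne.symm h)]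
  have hE : ∀ z, energy B₀ B θ (Function.update x j z)
      = localField B₀ B θ j z x + restEnergy B₀ B θ j x := by
    intro z
    rw [energy_split B₀ hB hθ j, hrest, Function.update_self, hloc]
  have hZ : (∑ y : Fin p → 𝒳, Real.exp (energy B₀ B θ y)) ≠ 0 :=
    (Finset.sum_pos (fun _ _ => Real.exp_pos _) ⟨x, Finset.mem_univ x⟩).ne'
  simp only [mrf, hE, Real.exp_add, ← Finset.sum_div, ← Finset.sum_mul, condProb]
  rw [div_div_div_cancel_right₀ hZ, mul_div_mul_right _ _ (Real.exp_pos _).ne']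

/-- The variance of `h(X_j)` under the conditional law of `X_j` given `X_{-j} = x_{-j}`. -/
def condVar (B₀ : 𝒳 → ℝ) (B : 𝒳 → 𝒳 → ℝ) (θ : Matrix (Fin p) (Fin p) ℝ) (j : Fin p)
    (h : 𝒳 → ℝ) (x : Fin p → 𝒳) : ℝ :=
  ∑ u : 𝒳, condProb B₀ B θ j u x * (h u - ∑ v : 𝒳, condProb B₀ B θ j v x * h v) ^ 2

/-- The negative log-pseudo-likelihood `φ(θ, x) = -∑_j log f_θ^{(j)}(x_j | x)`. -/
def phi (B₀ : 𝒳 → ℝ) (B : 𝒳 → 𝒳 → ℝ) (θ : Matrix (Fin p) (Fin p) ℝ) (x : Fin p → 𝒳) : ℝ :=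
  -∑ j : Fin p, Real.log (condProb B₀ B θ j (x j) x)

/-- The maximal fluctuation `c₀` of `B₀` and `B`. -/
def fluct (B₀ : 𝒳 → ℝ) (B : 𝒳 → 𝒳 → ℝ) : ℝ :=
  max (⨆ q : 𝒳 × 𝒳, |B₀ q.1 - B₀ q.2|) (⨆ q : 𝒳 × 𝒳 × 𝒳, |B q.1 q.2.1 - B q.1 q.2.2|)

/-- Restricted strong convexity at `θ` with constant `ρ > 0`. -/
def RestrictedStrongConvexity (B₀ : 𝒳 → ℝ) (B : 𝒳 → 𝒳 → ℝ) (θ : Matrix (Fin p) (Fin p) ℝ)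
    (ρ : ℝ) : Prop :=
  0 < ρ ∧ ∀ Δ ∈ cone θ,
    2 * ρ * normTwoSq Δ ≤
      ∑ i : Fin p, expect B₀ B θ fun x =>
        condVar B₀ B θ i (fun u => ∑ k : Fin p, Δ i k * pairFun B₀ B i k u (x k)) x

/-- The sample size requirement. -/
def SampleSize (c₀ : ℝ) (p T : ℕ) (α : ℝ) (θ₁ θ₂ : Matrix (Fin p) (Fin p) ℝ)
    (ρ₁ ρ₂ : ℝ) : Prop :=
  c₀ ^ 2 * max ((sparsity θ₁ : ℝ) ^ 2 / (α * ρ₁ ^ 2))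
      ((sparsity θ₂ : ℝ) ^ 2 / ((1 - α) * ρ₂ ^ 2)) ≤
    min ((T : ℝ) / (2 ^ 11 * Real.log (p * T)))
      ((T : ℝ) / (48 ^ 2 * 32 ^ 2 * Real.log (dimn p * T)))

/-- The signal `κ`. -/
def signal (B₀ : 𝒳 → ℝ) (B : 𝒳 → 𝒳 → ℝ) (θ₁ θ₂ : Matrix (Fin p) (Fin p) ℝ) : ℝ :=
  min (expect B₀ B θ₂ fun x => phi B₀ B θ₁ x - phi B₀ B θ₂ x)
    (expect B₀ B θ₁ fun x => phi B₀ B θ₂ x - phi B₀ B θ₁ x)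

/-- The conditions on the search domain `S` (with `τs` the true change-point). -/
structure IsSearchDomain (c₀ : ℝ) (p T τs : ℕ) (θ₁ θ₂ : Matrix (Fin p) (Fin p) ℝ)
    (ρ₁ ρ₂ : ℝ) (S : Finset ℕ) : Prop where
  subset : S ⊆ Finset.Icc 1 T
  mem : τs ∈ S
  right : ∀ τ ∈ S, τs < τ →
    c₀ * rowGap θ₁ θ₂ * ((τ : ℝ) - τs) ≤ 2 * √(τ * Real.log (dimn p * T)) ∧
    64 * c₀ ^ 3 * rowGap θ₁ θ₂ * sparsity θ₁ * ((τ : ℝ) - τs) ≤ ρ₁ * τ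
  left : ∀ τ ∈ S, τ ≤ τs →
    c₀ * rowGap θ₁ θ₂ * ((τs : ℝ) - τ) ≤ 2 * √(((T : ℝ) - τ) * Real.log (dimn p * T)) ∧
    64 * c₀ ^ 3 * rowGap θ₁ θ₂ * sparsity θ₂ * ((τs : ℝ) - τ) ≤ ρ₂ * ((T : ℝ) - τ)
  size : ∀ τ ∈ S,
    max (2 ^ 11) ((48 * 32) ^ 2) * c₀ ^ 4 * (sparsity θ₁ / ρ₁) ^ 2 * Real.log (dimn p * T)
      ≤ (τ : ℝ) ∧
    max (2 ^ 11) ((48 * 32) ^ 2) * c₀ ^ 4 * (sparsity θ₂ / ρ₂) ^ 2 * Real.log (dimn p * T)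
      ≤ (T : ℝ) - τ

/-- `M = (s₁/ρ₁)(1 + c₀ s₁/ρ₁) + (s₂/ρ₂)(1 + c₀ s₂/ρ₂)`. -/
def mConst (c₀ : ℝ) (θ₁ θ₂ : Matrix (Fin p) (Fin p) ℝ) (ρ₁ ρ₂ : ℝ) : ℝ :=
  sparsity θ₁ / ρ₁ * (1 + c₀ * (sparsity θ₁ / ρ₁)) +
    sparsity θ₂ / ρ₂ * (1 + c₀ * (sparsity θ₂ / ρ₂))

/-! ### The estimators, as functions of an observed sequence `x 1, …, x T` -/

/-- `(1/T) ∑_{t ∈ I} φ(θ, x_t)`. -/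
def loss (B₀ : 𝒳 → ℝ) (B : 𝒳 → 𝒳 → ℝ) (T : ℕ) (I : Finset ℕ) (x : ℕ → Fin p → 𝒳)
    (θ : Matrix (Fin p) (Fin p) ℝ) : ℝ :=
  1 / (T : ℝ) * ∑ t ∈ I, phi B₀ B θ (x t)

/-- `ℓ_T(τ; θ₁, θ₂)`. -/
def pseudoLogLik (B₀ : 𝒳 → ℝ) (B : 𝒳 → 𝒳 → ℝ) (T : ℕ) (x : ℕ → Fin p → 𝒳) (τ : ℕ)
    (θ₁ θ₂ : Matrix (Fin p) (Fin p) ℝ) : ℝ :=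
  loss B₀ B T (Finset.Icc 1 τ) x θ₁ + loss B₀ B T (Finset.Icc (τ + 1) T) x θ₂

/-- `θ` minimizes `ϑ ↦ (1/T) ∑_{t ∈ I} φ(ϑ, x_t) + lam ‖ϑ‖₁` over the symmetric matrices. -/
def IsPenalizedMinimizer (B₀ : 𝒳 → ℝ) (B : 𝒳 → 𝒳 → ℝ) (T : ℕ) (I : Finset ℕ)
    (x : ℕ → Fin p → 𝒳) (lam : ℝ) (θ : Matrix (Fin p) (Fin p) ℝ) : Prop :=
  θ.IsSymm ∧ ∀ ϑ : Matrix (Fin p) (Fin p) ℝ, ϑ.IsSymm →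
    loss B₀ B T I x θ + lam * normOne θ ≤ loss B₀ B T I x ϑ + lam * normOne ϑ

/-- The penalty `32 c₀ √(n log(dT)) / T` for `n` observations: `n = τ` gives `λ_{1,τ}`, and
`n = T - τ` gives `λ_{2,τ}`. -/
def penalty (c₀ : ℝ) (p T : ℕ) (n : ℝ) : ℝ :=
  32 * c₀ * √(n * Real.log (dimn p * T)) / T

/-- `τhat` is a profile penalized pseudo-likelihood estimate of the change-point: it minimizes
`τ ↦ ℓ_T(τ; θ₁hat τ, θ₂hat τ)` over `S`, where `θ₁hat τ`, `θ₂hat τ` are penalized estimates. -/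
structure IsChangePointEstimate (B₀ : 𝒳 → ℝ) (B : 𝒳 → 𝒳 → ℝ) (T : ℕ) (S : Finset ℕ)
    (x : ℕ → Fin p → 𝒳) (θ₁hat θ₂hat : ℕ → Matrix (Fin p) (Fin p) ℝ) (τhat : ℕ) : Prop where
  first : ∀ τ ∈ S, IsPenalizedMinimizer B₀ B T (Finset.Icc 1 τ) x
    (penalty (fluct B₀ B) p T τ) (θ₁hat τ)
  second : ∀ τ ∈ S, IsPenalizedMinimizer B₀ B T (Finset.Icc (τ + 1) T) x
    (penalty (fluct B₀ B) p T ((T : ℝ) - τ)) (θ₂hat τ)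
  mem : τhat ∈ S
  le : ∀ τ ∈ S, pseudoLogLik B₀ B T x τhat (θ₁hat τhat) (θ₂hat τhat) ≤
    pseudoLogLik B₀ B T x τ (θ₁hat τ) (θ₂hat τ)

/-- The observations `X 1, …, X T` are independent, with law `g_{θ₁}` up to time `τs` and law
`g_{θ₂}` afterwards. -/
structure IsSingleChangePointModel {Ω : Type*} [MeasurableSpace Ω] [MeasurableSpace 𝒳]
    (μ : Measure Ω) (B₀ : 𝒳 → ℝ) (B : 𝒳 → 𝒳 → ℝ) (θ₁ θ₂ : Matrix (Fin p) (Fin p) ℝ)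
    (T τs : ℕ) (X : ℕ → Ω → Fin p → 𝒳) : Prop where
  measurable : ∀ t ∈ Finset.Icc 1 T, Measurable (X t)
  indep : iIndepFun (fun (t : Finset.Icc 1 T) => X t) μ
  before : ∀ t ∈ Finset.Icc 1 τs, ∀ x, μ.real (X t ⁻¹' {x}) = mrf B₀ B θ₁ x
  after : ∀ t ∈ Finset.Icc (τs + 1) T, ∀ x, μ.real (X t ⁻¹' {x}) = mrf B₀ B θ₂ x

end Model

end

end MRFChangePoint

open MRFChangePoint

/-! Write `L = log (dT)` and `rᵢ = c₀² sᵢ / ρᵢ`. On a typical sample, moving the split away from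
`τs` by a lag `m` raises the loss at the true parameters by more than `κ m / 2`, while replacing
true parameters by estimates changes a segment's loss only by a multiple of `rᵢ L`. A minimizing
split therefore cannot have `κ m` much larger than `(r₁ + r₂) L`.

The estimation error is governed by an oracle inequality (`abs_sum_phi_sub_le`) for segments at
least half of which follow the law `g_θ`. Subtracting the score term from the increment of `φ`
leaves a sum of conditional cumulant generating functions of centred variables (`phi_add`). Hence
the excess loss is nonnegative and, by Jensen's inequality for a power, bounded below by the
conditional variance even for large perturbations (`condVar_le_excess`). The penalty dominates the
score, including the bias from observations of the other law, so the error lies in the cone; there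
the empirical conditional variance inherits restricted strong convexity from its mean
(`le_sum_quadForm`).

If at the estimated split the dominant law of each segment is the expected one, comparing the losses
at this split and at `τs` bounds the lag. Otherwise the lag is at least half the length of the
contaminated segment. Then the gap condition on the search domain makes `b` small, and `κ ≤ 2 s (c₀
b)²` (`signal_le`) again bounds `κ` times the lag, now by `16 s L` (`mul_lag_le`). Since restricted
strong convexity forces `ρᵢ ≤ c₀²` unless `sᵢ = 0`, one has `s ≤ r₁ + r₂`, and both cases are
covered by the same `δ` (`abs_estimate_sub_le`).

Typicality follows from Hoeffding's inequality and union bounds (`measure_not_isTypical_le`): scores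
and covariances account for `16 / d`, and the signal at all large lags for two geometric series.
When `4δ/κ < 2` the asserted bound is at least one. -/

namespace MRFChangePoint

/-! ### Exponential moments of centred variables on a finite probability space -/

section Weights

variable {ι : Type*} [Fintype ι] {w Y : ι → ℝ} {R t : ℝ}

lemma one_le_sum_exp (hw : ∀ u, 0 ≤ w u) (hw1 : ∑ u, w u = 1) (hY : ∑ u, w u * Y u = 0) :
    1 ≤ ∑ u, w u * Real.exp (Y u) := by
  have : ∑ u, w u * (Y u + 1) ≤ ∑ u, w u * Real.exp (Y u) :=
    Finset.sum_le_sum fun u _ => mul_le_mul_of_nonneg_left (Real.add_one_le_exp _) (hw u)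
  simp only [mul_add, Finset.sum_add_distrib, hY, mul_one, hw1] at this
  linarith

lemma log_sum_exp_nonneg (hw : ∀ u, 0 ≤ w u) (hw1 : ∑ u, w u = 1)
    (hY : ∑ u, w u * Y u = 0) : 0 ≤ Real.log (∑ u, w u * Real.exp (Y u)) :=
  Real.log_nonneg (one_le_sum_exp hw hw1 hY)

lemma exp_le_one_add_add_sq {y : ℝ} (hy : |y| ≤ 1) : Real.exp y ≤ 1 + y + y ^ 2 := by
  have := (abs_le.1 (Real.abs_exp_sub_one_sub_id_le hy)).2
  linarith

lemma one_add_add_sq_div_le_exp {y : ℝ} (hy : |y| ≤ 1) : 1 + y + y ^ 2 / 3 ≤ Real.exp y := by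
  -- At order five, the surplus `y² / 6` and the cubic term combine to `y² (1 + y) / 6 ≥ 0`, and the
  -- quartic term absorbs the remainder.
  have h := Real.exp_bound hy (n := 5) (by norm_num)
  have h1 := (abs_le.1 h).1
  simp only [Finset.sum_range_succ, Finset.sum_range_zero, Nat.factorial] at h1
  norm_num at h1
  have h5 : |y| ^ 5 ≤ y ^ 4 := by
    have h4 : |y| ^ 4 = y ^ 4 := by rw [← abs_pow, abs_of_nonneg (by positivity)]
    rw [pow_succ, h4]
    exact mul_le_of_le_one_right (by positivity) hy
  have h6 : 0 ≤ y ^ 2 * (1 + y) := mul_nonneg (sq_nonneg y) (by linarith [(abs_le.1 hy).1])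
  nlinarith [pow_nonneg (sq_nonneg y) 2]

/-- For `R ≤ 1`, centring and the second order bound on the exponential give `1 + R² ≤ exp (R²)`;
for `R > 1` it suffices that `Y ≤ R ≤ R²`. -/
lemma log_sum_exp_le_sq (hw : ∀ u, 0 ≤ w u) (hw1 : ∑ u, w u = 1)
    (hY : ∑ u, w u * Y u = 0) (hR : ∀ u, |Y u| ≤ R) :
    Real.log (∑ u, w u * Real.exp (Y u)) ≤ R ^ 2 := by
  have hpos : 0 < ∑ u, w u * Real.exp (Y u) :=
    zero_lt_one.trans_le (one_le_sum_exp hw hw1 hY)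
  rw [Real.log_le_iff_le_exp hpos]
  have hR2 : ∀ u, Y u ^ 2 ≤ R ^ 2 := fun u =>
    sq_le_sq' (by linarith [(abs_le.1 (hR u)).1]) (abs_le.1 (hR u)).2
  by_cases h1 : R ≤ 1
  · calc ∑ u, w u * Real.exp (Y u) ≤ ∑ u, w u * (1 + Y u + R ^ 2) :=
          Finset.sum_le_sum fun u _ => mul_le_mul_of_nonneg_left
            ((exp_le_one_add_add_sq ((hR u).trans h1)).trans (by linarith [hR2 u])) (hw u)
      _ = 1 + R ^ 2 := by
          simp only [mul_add, Finset.sum_add_distrib, hY, ← Finset.sum_mul, hw1]; ring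
      _ ≤ Real.exp (R ^ 2) := by linarith [Real.add_one_le_exp (R ^ 2)]
  · calc ∑ u, w u * Real.exp (Y u) ≤ ∑ u, w u * Real.exp (R ^ 2) :=
          Finset.sum_le_sum fun u _ => mul_le_mul_of_nonneg_left
            (Real.exp_le_exp.2 ((abs_le.1 (hR u)).2.trans (by nlinarith))) (hw u)
      _ = Real.exp (R ^ 2) := by rw [← Finset.sum_mul, hw1, one_mul]

/-- A quantitative Jensen inequality for the cumulant generating function. -/
lemma variance_le_log_sum_exp (hw : ∀ u, 0 ≤ w u) (hw1 : ∑ u, w u = 1)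
    (hY : ∑ u, w u * Y u = 0) (hR : ∀ u, |Y u| ≤ R) (ht : 0 < t) (ht1 : t ≤ 1)
    (htR : t * R ≤ 1) :
    t / 4 * ∑ u, w u * Y u ^ 2 ≤ Real.log (∑ u, w u * Real.exp (Y u)) := by
  set V := ∑ u, w u * Y u ^ 2 with hV
  have htY : ∀ u, |t * Y u| ≤ 1 := fun u => by
    rw [abs_mul, abs_of_pos ht]
    exact (mul_le_mul_of_nonneg_left (hR u) ht.le).trans htR
  have hV0 : 0 ≤ V := Finset.sum_nonneg fun u _ => mul_nonneg (hw u) (sq_nonneg _)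
  have hV1 : t ^ 2 * V ≤ 1 := by
    rw [hV, Finset.mul_sum, ← hw1]
    refine Finset.sum_le_sum fun u _ => ?_
    have : (t * Y u) ^ 2 ≤ 1 := (sq_le_one_iff_abs_le_one _).2 (htY u)
    nlinarith [hw u]
  have h1 : 1 + t ^ 2 * V / 3 ≤ ∑ u, w u * Real.exp (t * Y u) := by
    calc 1 + t ^ 2 * V / 3 = ∑ u, w u * (1 + t * Y u + (t * Y u) ^ 2 / 3) := by
          have : ∀ u, w u * (1 + t * Y u + (t * Y u) ^ 2 / 3)
            = w u + t * (w u * Y u) + t ^ 2 / 3 * (w u * Y u ^ 2) := fun u => by ring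
          simp only [this, Finset.sum_add_distrib, ← Finset.mul_sum, hw1, hY, ← hV]; ring
      _ ≤ _ := Finset.sum_le_sum fun u _ =>
          mul_le_mul_of_nonneg_left (one_add_add_sq_div_le_exp (htY u)) (hw u)
  -- Jensen's inequality for the concave power `y ↦ y ^ t` passes to the shrunk variable `t Y`,
  -- which stays in `[-1, 1]`, where the exponential has a quadratic minorant.
  have h2 : ∑ u, w u * Real.exp (t * Y u) ≤ (∑ u, w u * Real.exp (Y u)) ^ t := by
    have := (Real.concaveOn_rpow ht.le ht1).le_map_sum (t := Finset.univ) (w := w)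
      (p := fun u => Real.exp (Y u)) (fun u _ => hw u) hw1 (fun u _ => (Real.exp_pos _).le)
    simpa only [smul_eq_mul, ← Real.exp_mul, mul_comm t] using this
  have hS : 0 < ∑ u, w u * Real.exp (Y u) :=
    zero_lt_one.trans_le (one_le_sum_exp hw hw1 hY)
  have h3 : Real.log (1 + t ^ 2 * V / 3) ≤ t * Real.log (∑ u, w u * Real.exp (Y u)) := by
    rw [← Real.log_rpow hS]
    exact Real.log_le_log (by positivity) (h1.trans h2)
  -- `log (1 + z) ≥ z / (1 + z) ≥ 3 z / 4` for `z = t² V / 3 ≤ 1 / 3`.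
  have h4 : t ^ 2 * V / 4 ≤ Real.log (1 + t ^ 2 * V / 3) := by
    have hz : 0 < 1 + t ^ 2 * V / 3 := by positivity
    refine le_trans ?_ (Real.one_sub_inv_le_log_of_pos hz)
    rw [← one_div, le_sub_iff_add_le, ← le_sub_iff_add_le', div_le_iff₀ hz]
    nlinarith [mul_nonneg (sq_nonneg t) hV0]
  have h5 : t * (t / 4 * V) ≤ t * Real.log (∑ u, w u * Real.exp (Y u)) := by
    linarith [h3, h4, show t * (t / 4 * V) = t ^ 2 * V / 4 by ring]
  exact le_of_mul_le_mul_left h5 ht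

lemma abs_mean_sub_le_of_osc {h : ι → ℝ} {c m : ℝ} (hw : ∀ u, 0 ≤ w u) (hw1 : ∑ u, w u = 1)
    (hc : ∀ u, |m - h u| ≤ c) : |m - ∑ u, w u * h u| ≤ c := by
  have : m - ∑ u, w u * h u = ∑ u, w u * (m - h u) := by
    simp only [mul_sub, Finset.sum_sub_distrib, ← Finset.sum_mul, hw1, one_mul]
  rw [this]
  calc |∑ u, w u * (m - h u)| ≤ ∑ u, |w u * (m - h u)| := Finset.abs_sum_le_sum_abs _ _
    _ ≤ ∑ u, w u * c := Finset.sum_le_sum fun u _ => by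
        rw [abs_mul, abs_of_nonneg (hw u)]
        exact mul_le_mul_of_nonneg_left (hc u) (hw u)
    _ = c := by rw [← Finset.sum_mul, hw1, one_mul]

/-- Two probability vectors with `w₂ ≤ exp R * w₁` have means that differ by at most `R` times the
oscillation. -/
lemma abs_mean_sub_mean_le {w₁ w₂ h : ι → ℝ} {c : ℝ} (hw : ∀ u, 0 ≤ w₂ u)
    (h1 : ∑ u, w₁ u = 1) (h2 : ∑ u, w₂ u = 1) (hc0 : 0 ≤ c) (hc : ∀ u v, |h u - h v| ≤ c)
    (hR : ∀ u, w₂ u ≤ Real.exp R * w₁ u) :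
    |∑ u, w₁ u * h u - ∑ u, w₂ u * h u| ≤ c * R := by
  set β := ∑ u, w₂ u * h u with hβ
  have hhβ : ∀ u, |h u - β| ≤ c := fun u => abs_mean_sub_le_of_osc hw h2 (hc u)
  have hge : ∀ u, 0 ≤ w₁ u - Real.exp (-R) * w₂ u := fun u => by
    have := mul_le_mul_of_nonneg_left (hR u) (Real.exp_pos (-R)).le
    rw [← mul_assoc, ← Real.exp_add, neg_add_cancel, Real.exp_zero, one_mul] at this
    linarith
  have hβ0 : ∑ u, w₂ u * (h u - β) = 0 := by
    simp only [mul_sub, Finset.sum_sub_distrib, ← Finset.sum_mul, h2, ← hβ]; ring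
  -- The weights `w₁ - exp (-R) w₂` are nonnegative with total mass `1 - exp (-R) ≤ R`; centring `h`
  -- at its `w₂`-mean makes the subtracted part contribute nothing.
  have e : ∑ u, w₁ u * h u - β = ∑ u, (w₁ u - Real.exp (-R) * w₂ u) * (h u - β) := by
    have : ∀ u, (w₁ u - Real.exp (-R) * w₂ u) * (h u - β)
      = w₁ u * h u - w₁ u * β - Real.exp (-R) * (w₂ u * (h u - β)) := fun u => by ring
    simp only [this, Finset.sum_sub_distrib, ← Finset.mul_sum, hβ0, ← Finset.sum_mul, h1]
    ring
  rw [e]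
  calc _ ≤ ∑ u, |(w₁ u - Real.exp (-R) * w₂ u) * (h u - β)| := Finset.abs_sum_le_sum_abs _ _
    _ ≤ ∑ u, (w₁ u - Real.exp (-R) * w₂ u) * c := Finset.sum_le_sum fun u _ => by
        rw [abs_mul, abs_of_nonneg (hge u)]
        exact mul_le_mul_of_nonneg_left (hhβ u) (hge u)
    _ = (1 - Real.exp (-R)) * c := by
        rw [← Finset.sum_mul, Finset.sum_sub_distrib, ← Finset.mul_sum, h1, h2, mul_one]
    _ ≤ c * R := by nlinarith [Real.add_one_le_exp (-R)]

end Weights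

/-! ### Conditional laws, score and expansion of the pseudo-likelihood -/

section ModelLemmas

variable {p : ℕ} {𝒳 : Type*} {B₀ : 𝒳 → ℝ} {B : 𝒳 → 𝒳 → ℝ}
  {θ θ' Δ : Matrix (Fin p) (Fin p) ℝ} {j k : Fin p} {x : Fin p → 𝒳}

lemma fluct_nonneg (B₀ : 𝒳 → ℝ) (B : 𝒳 → 𝒳 → ℝ) : 0 ≤ fluct B₀ B :=
  le_max_of_le_left (Real.iSup_nonneg fun _ => abs_nonneg _)

lemma localField_add (θ Δ : Matrix (Fin p) (Fin p) ℝ) (j : Fin p) (u : 𝒳) (x : Fin p → 𝒳) :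
    localField B₀ B (θ + Δ) j u x = localField B₀ B θ j u x + localField B₀ B Δ j u x := by
  simp [localField, add_mul, Finset.sum_add_distrib]

lemma pairFun_update (j k : Fin p) (u v : 𝒳) (x : Fin p → 𝒳) :
    pairFun B₀ B j k u (Function.update x j v k) = pairFun B₀ B j k u (x k) := by
  by_cases h : j = k
  · simp [pairFun, h]
  · rw [Function.update_of_ne (Ne.symm h)]

variable [Fintype 𝒳]

lemma abs_pairFun_sub_le (hB : ∀ u v, B u v = B v u) (j k : Fin p) (u v y : 𝒳) :
    |pairFun B₀ B j k u y - pairFun B₀ B j k v y| ≤ fluct B₀ B := by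
  unfold pairFun fluct
  split_ifs
  · exact le_max_of_le_left
      (le_ciSup (f := fun q : 𝒳 × 𝒳 => |B₀ q.1 - B₀ q.2|) (Set.finite_range _).bddAbove (u, v))
  -- `c₀` measures the oscillation in the second argument of `B`, the local field varies the first;
  -- symmetry exchanges them.
  · rw [hB u y, hB v y]
    exact le_max_of_le_right
      (le_ciSup (f := fun q : 𝒳 × 𝒳 × 𝒳 => |B q.1 q.2.1 - B q.1 q.2.2|)
        (Set.finite_range _).bddAbove (y, u, v))

lemma abs_localField_sub_le (hB : ∀ u v, B u v = B v u) (Δ : Matrix (Fin p) (Fin p) ℝ)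
    (j : Fin p) (u v : 𝒳) (x : Fin p → 𝒳) :
    |localField B₀ B Δ j u x - localField B₀ B Δ j v x| ≤ fluct B₀ B * ∑ k, |Δ j k| := by
  unfold localField
  rw [← Finset.sum_sub_distrib, Finset.mul_sum]
  refine (Finset.abs_sum_le_sum_abs _ _).trans (Finset.sum_le_sum fun k _ => ?_)
  rw [← mul_sub, abs_mul, mul_comm]
  exact mul_le_mul_of_nonneg_right (abs_pairFun_sub_le hB _ _ _ _ _) (abs_nonneg _)

lemma condProb_update (θ : Matrix (Fin p) (Fin p) ℝ) (j : Fin p) (u v : 𝒳) (x : Fin p → 𝒳) :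
    condProb B₀ B θ j u (Function.update x j v) = condProb B₀ B θ j u x := by
  simp [condProb, localField, pairFun_update]

lemma sum_exp_localField_pos (θ : Matrix (Fin p) (Fin p) ℝ) (j : Fin p) (x : Fin p → 𝒳) :
    0 < ∑ z : 𝒳, Real.exp (localField B₀ B θ j z x) :=
  Finset.sum_pos (fun _ _ => Real.exp_pos _) ⟨x j, Finset.mem_univ _⟩

lemma condProb_pos (θ : Matrix (Fin p) (Fin p) ℝ) (j : Fin p) (u : 𝒳) (x : Fin p → 𝒳) :
    0 < condProb B₀ B θ j u x :=
  div_pos (Real.exp_pos _) (sum_exp_localField_pos θ j x)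

lemma sum_condProb (θ : Matrix (Fin p) (Fin p) ℝ) (j : Fin p) (x : Fin p → 𝒳) :
    ∑ u, condProb B₀ B θ j u x = 1 := by
  simp only [condProb, ← Finset.sum_div]
  exact div_self (sum_exp_localField_pos θ j x).ne'

/-- Changing the parameter changes the conditional probabilities at most by a bounded factor. -/
lemma condProb_le_exp_mul (hB : ∀ u v, B u v = B v u) (θ θ' : Matrix (Fin p) (Fin p) ℝ)
    (j : Fin p) (u : 𝒳) (x : Fin p → 𝒳) :
    condProb B₀ B θ' j u x
      ≤ Real.exp (fluct B₀ B * ∑ k, |(θ' - θ) j k|) * condProb B₀ B θ j u x := by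
  set R := fluct B₀ B * ∑ k, |(θ' - θ) j k| with hR
  have e : ∀ z, localField B₀ B θ' j z x
      = localField B₀ B θ j z x + localField B₀ B (θ' - θ) j z x := fun z => by
    rw [← localField_add, add_sub_cancel]
  unfold condProb
  -- Cross-multiplication compares `u` with each `z` termwise, so the oscillation of the
  -- perturbation enters once: the factor is `exp R`, not `exp (2R)`.
  rw [← mul_div_assoc, div_le_div_iff₀ (sum_exp_localField_pos θ' j x)
    (sum_exp_localField_pos θ j x), Finset.mul_sum, Finset.mul_sum]
  refine Finset.sum_le_sum fun z _ => ?_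
  rw [← Real.exp_add, ← Real.exp_add, ← Real.exp_add, Real.exp_le_exp, e u, e z]
  have := (abs_le.1 (abs_localField_sub_le (B₀ := B₀) hB (θ' - θ) j u z x)).2
  linarith

/-! ### The law `g_θ` -/

lemma mrf_pos (θ : Matrix (Fin p) (Fin p) ℝ) (x : Fin p → 𝒳) : 0 < mrf B₀ B θ x :=
  div_pos (Real.exp_pos _) (Finset.sum_pos (fun _ _ => Real.exp_pos _) ⟨x, Finset.mem_univ _⟩)

lemma sum_mrf [Nonempty 𝒳] (θ : Matrix (Fin p) (Fin p) ℝ) :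
    ∑ x : Fin p → 𝒳, mrf B₀ B θ x = 1 := by
  simp only [mrf, ← Finset.sum_div]
  exact div_self (Finset.sum_pos (fun _ _ => Real.exp_pos _) Finset.univ_nonempty).ne'

lemma expect_mono {F G : (Fin p → 𝒳) → ℝ} (h : ∀ x, F x ≤ G x) :
    expect B₀ B θ F ≤ expect B₀ B θ G :=
  Finset.sum_le_sum fun x _ => mul_le_mul_of_nonneg_left (h x) (mrf_pos θ x).le

lemma expect_const [Nonempty 𝒳] (θ : Matrix (Fin p) (Fin p) ℝ) (c : ℝ) :
    expect B₀ B θ (fun _ => c) = c := by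
  rw [expect, ← Finset.sum_mul, sum_mrf, one_mul]

lemma abs_expect_le [Nonempty 𝒳] {F : (Fin p → 𝒳) → ℝ} {c : ℝ} (h : ∀ x, |F x| ≤ c) :
    |expect B₀ B θ F| ≤ c := by
  refine abs_le.2 ⟨?_, ?_⟩
  · rw [← expect_const (B₀ := B₀) (B := B) θ (-c)]
    exact expect_mono fun x => (abs_le.1 (h x)).1
  · rw [← expect_const (B₀ := B₀) (B := B) θ c]
    exact expect_mono fun x => (abs_le.1 (h x)).2

lemma expect_sub (F G : (Fin p → 𝒳) → ℝ) :
    expect B₀ B θ (fun x => F x - G x) = expect B₀ B θ F - expect B₀ B θ G := by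
  simp [expect, mul_sub, Finset.sum_sub_distrib]

lemma expect_mul_left (a : ℝ) (F : (Fin p → 𝒳) → ℝ) :
    expect B₀ B θ (fun x => a * F x) = a * expect B₀ B θ F := by
  rw [expect, expect, Finset.mul_sum]
  exact Finset.sum_congr rfl fun x _ => by ring

lemma expect_sum {ι : Type*} (s : Finset ι) (F : ι → (Fin p → 𝒳) → ℝ) :
    expect B₀ B θ (fun x => ∑ i ∈ s, F i x) = ∑ i ∈ s, expect B₀ B θ (F i) := by
  simp only [expect, Finset.mul_sum]
  exact Finset.sum_comm

/-- The tower property for the conditional law of one coordinate. -/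
lemma expect_condProb (hB : ∀ u v, B u v = B v u) (hθ : θ.IsSymm) (j : Fin p)
    (F : (Fin p → 𝒳) → ℝ) :
    expect B₀ B θ (fun x => ∑ u, condProb B₀ B θ j u x * F (Function.update x j u))
      = expect B₀ B θ F := by
  classical
  set g := mrf B₀ B θ
  set Z : (Fin p → 𝒳) → ℝ := fun x => ∑ z, g (Function.update x j z) with hZ
  have hZpos : ∀ x, 0 < Z x := fun x =>
    Finset.sum_pos (fun _ _ => mrf_pos θ _) ⟨x j, Finset.mem_univ _⟩
  have hZu : ∀ x u, Z (Function.update x j u) = Z x := fun x u => by simp [hZ]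
  -- Reversibility of resampling one coordinate: exchanging `x j` with the fresh value preserves the
  -- weight `g x * g x' / Z`, because `Z` does not depend on the coordinate `j`.
  let σ : (Fin p → 𝒳) × 𝒳 → (Fin p → 𝒳) × 𝒳 := fun q => (Function.update q.1 j q.2, q.1 j)
  have hσ : Function.Involutive σ := fun q => by simp [σ]
  let Ψ : (Fin p → 𝒳) × 𝒳 → ℝ := fun q =>
    g q.1 * (g (Function.update q.1 j q.2) / Z q.1 * F (Function.update q.1 j q.2))
  have h1 : expect B₀ B θ (fun x => ∑ u, condProb B₀ B θ j u x * F (Function.update x j u))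
      = ∑ q, Ψ q := by
    rw [Fintype.sum_prod_type]
    unfold expect
    refine Finset.sum_congr rfl fun x _ => ?_
    rw [Finset.mul_sum]
    refine Finset.sum_congr rfl fun u _ => ?_
    rw [condProb_eq B₀ hB hθ]
  have h2 : ∑ q, Ψ q = ∑ q, Ψ (σ q) := (Equiv.sum_comp hσ.toPerm Ψ).symm
  rw [h1, h2, Fintype.sum_prod_type]
  unfold expect
  refine Finset.sum_congr rfl fun x _ => ?_
  have : ∀ u, Ψ (σ (x, u)) = g (Function.update x j u) * (g x * F x / Z x) := fun u => by
    simp only [Ψ, σ, hZu, Function.update_idem, Function.update_eq_self]; ring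
  simp only [this, ← Finset.sum_mul]
  change Z x * _ = _
  field_simp [(hZpos x).ne']
  exact mul_comm _ _

/-! ### Score, conditional covariances and excess loss -/

/-- The coordinate `(j, k)` of the score of the pseudo-likelihood. -/
noncomputable def score (B₀ : 𝒳 → ℝ) (B : 𝒳 → 𝒳 → ℝ) (θ : Matrix (Fin p) (Fin p) ℝ)
    (j k : Fin p) (x : Fin p → 𝒳) : ℝ :=
  pairFun B₀ B j k (x j) (x k) - ∑ u, condProb B₀ B θ j u x * pairFun B₀ B j k u (x k)

/-- The conditional covariance of `B_ik(X_i, x_k)` and `B_il(X_i, x_l)`. -/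
noncomputable def condCov (B₀ : 𝒳 → ℝ) (B : 𝒳 → 𝒳 → ℝ) (θ : Matrix (Fin p) (Fin p) ℝ)
    (i k l : Fin p) (x : Fin p → 𝒳) : ℝ :=
  ∑ u, condProb B₀ B θ i u x *
    ((pairFun B₀ B i k u (x k) - ∑ v, condProb B₀ B θ i v x * pairFun B₀ B i k v (x k)) *
     (pairFun B₀ B i l u (x l) - ∑ v, condProb B₀ B θ i v x * pairFun B₀ B i l v (x l)))

/-- The conditional mean of the local field. -/
noncomputable def meanField (B₀ : 𝒳 → ℝ) (B : 𝒳 → 𝒳 → ℝ) (θ Δ : Matrix (Fin p) (Fin p) ℝ)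
    (j : Fin p) (x : Fin p → 𝒳) : ℝ :=
  ∑ u, condProb B₀ B θ j u x * localField B₀ B Δ j u x

/-- The remainder of the first order expansion of `φ(·, x)` at `θ` in the direction `Δ`. -/
noncomputable def excess (B₀ : 𝒳 → ℝ) (B : 𝒳 → 𝒳 → ℝ) (θ Δ : Matrix (Fin p) (Fin p) ℝ)
    (x : Fin p → 𝒳) : ℝ :=
  ∑ j, Real.log (∑ u, condProb B₀ B θ j u x *
    Real.exp (localField B₀ B Δ j u x - meanField B₀ B θ Δ j x))

lemma abs_score_le (hB : ∀ u v, B u v = B v u) (θ : Matrix (Fin p) (Fin p) ℝ) (j k : Fin p)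
    (x : Fin p → 𝒳) : |score B₀ B θ j k x| ≤ fluct B₀ B :=
  abs_mean_sub_le_of_osc (fun u => (condProb_pos θ j u x).le) (sum_condProb θ j x)
    fun _ => abs_pairFun_sub_le hB _ _ _ _ _

lemma abs_condCov_le (hB : ∀ u v, B u v = B v u) (θ : Matrix (Fin p) (Fin p) ℝ) (i k l : Fin p)
    (x : Fin p → 𝒳) : |condCov B₀ B θ i k l x| ≤ fluct B₀ B ^ 2 := by
  have h : ∀ k u, |pairFun B₀ B i k u (x k)
      - ∑ v, condProb B₀ B θ i v x * pairFun B₀ B i k v (x k)| ≤ fluct B₀ B := fun k u =>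
    abs_mean_sub_le_of_osc (fun u => (condProb_pos θ i u x).le) (sum_condProb θ i x)
      fun _ => abs_pairFun_sub_le hB _ _ _ _ _
  calc |condCov B₀ B θ i k l x|
      ≤ ∑ u, condProb B₀ B θ i u x * fluct B₀ B ^ 2 := by
        refine (Finset.abs_sum_le_sum_abs _ _).trans (Finset.sum_le_sum fun u _ => ?_)
        rw [abs_mul, abs_of_pos (condProb_pos θ i u x), abs_mul, sq]
        exact mul_le_mul_of_nonneg_left
          (mul_le_mul (h k u) (h l u) (abs_nonneg _) (fluct_nonneg B₀ B)) (condProb_pos θ i u x).le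
    _ = fluct B₀ B ^ 2 := by rw [← Finset.sum_mul, sum_condProb, one_mul]

lemma meanField_eq (θ Δ : Matrix (Fin p) (Fin p) ℝ) (j : Fin p) (x : Fin p → 𝒳) :
    meanField B₀ B θ Δ j x
      = ∑ k, Δ j k * ∑ u, condProb B₀ B θ j u x * pairFun B₀ B j k u (x k) := by
  simp only [meanField, localField, Finset.mul_sum]
  rw [Finset.sum_comm]
  exact Finset.sum_congr rfl fun _ _ => Finset.sum_congr rfl fun _ _ => by ring

lemma condVar_eq (θ Δ : Matrix (Fin p) (Fin p) ℝ) (i : Fin p) (x : Fin p → 𝒳) :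
    condVar B₀ B θ i (fun u => ∑ k, Δ i k * pairFun B₀ B i k u (x k)) x
      = ∑ k, ∑ l, Δ i k * Δ i l * condCov B₀ B θ i k l x := by
  have hm : ∑ v, condProb B₀ B θ i v x * ∑ k, Δ i k * pairFun B₀ B i k v (x k)
      = ∑ k, Δ i k * ∑ u, condProb B₀ B θ i u x * pairFun B₀ B i k u (x k) :=
    meanField_eq θ Δ i x
  unfold condVar
  rw [hm]
  have hsq : ∀ u, (∑ k, Δ i k * pairFun B₀ B i k u (x k)
      - ∑ k, Δ i k * ∑ u, condProb B₀ B θ i u x * pairFun B₀ B i k u (x k)) ^ 2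
      = ∑ k, ∑ l, Δ i k * Δ i l *
        ((pairFun B₀ B i k u (x k) - ∑ v, condProb B₀ B θ i v x * pairFun B₀ B i k v (x k)) *
        (pairFun B₀ B i l u (x l) - ∑ v, condProb B₀ B θ i v x * pairFun B₀ B i l v (x l))) := by
    intro u
    rw [← Finset.sum_sub_distrib, sq, Finset.sum_mul_sum]
    exact Finset.sum_congr rfl fun k _ => Finset.sum_congr rfl fun l _ => by ring
  simp only [hsq, condCov, Finset.mul_sum (s := Finset.univ (α := Fin p))]
  rw [Finset.sum_comm]
  refine Finset.sum_congr rfl fun k _ => ?_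
  rw [Finset.sum_comm]
  refine Finset.sum_congr rfl fun l _ => ?_
  rw [Finset.mul_sum]
  exact Finset.sum_congr rfl fun u _ => by ring

lemma sum_condProb_mul_localField_sub (θ Δ : Matrix (Fin p) (Fin p) ℝ) (j : Fin p)
    (x : Fin p → 𝒳) :
    ∑ u, condProb B₀ B θ j u x * (localField B₀ B Δ j u x - meanField B₀ B θ Δ j x) = 0 := by
  simp only [mul_sub, Finset.sum_sub_distrib, ← Finset.sum_mul, sum_condProb, one_mul]
  exact sub_self _

lemma abs_localField_sub_meanField_le (hB : ∀ u v, B u v = B v u)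
    (θ Δ : Matrix (Fin p) (Fin p) ℝ) (j : Fin p) (u : 𝒳) (x : Fin p → 𝒳) :
    |localField B₀ B Δ j u x - meanField B₀ B θ Δ j x| ≤ fluct B₀ B * ∑ k, |Δ j k| :=
  abs_mean_sub_le_of_osc (fun u => (condProb_pos θ j u x).le) (sum_condProb θ j x)
    fun _ => abs_localField_sub_le hB _ _ _ _ _

lemma excess_nonneg (θ Δ : Matrix (Fin p) (Fin p) ℝ) (x : Fin p → 𝒳) :
    0 ≤ excess B₀ B θ Δ x :=
  Finset.sum_nonneg fun j _ => log_sum_exp_nonneg (fun u => (condProb_pos θ j u x).le)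
    (sum_condProb θ j x) (sum_condProb_mul_localField_sub θ Δ j x)

lemma excess_le (hB : ∀ u v, B u v = B v u) (θ Δ : Matrix (Fin p) (Fin p) ℝ) (x : Fin p → 𝒳) :
    excess B₀ B θ Δ x ≤ ∑ j, (fluct B₀ B * ∑ k, |Δ j k|) ^ 2 :=
  Finset.sum_le_sum fun j _ => log_sum_exp_le_sq (fun u => (condProb_pos θ j u x).le)
    (sum_condProb θ j x) (sum_condProb_mul_localField_sub θ Δ j x)
    fun u => abs_localField_sub_meanField_le hB θ Δ j u x

/-- The free parameter `t` is needed because no a priori bound on the size of `Δ` is available: `t =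
1` serves small perturbations and the reciprocal of their size serves large ones. -/
lemma condVar_le_excess (hB : ∀ u v, B u v = B v u) (θ Δ : Matrix (Fin p) (Fin p) ℝ)
    (x : Fin p → 𝒳) {t : ℝ} (ht : 0 < t) (ht1 : t ≤ 1)
    (htR : ∀ j, t * (fluct B₀ B * ∑ k, |Δ j k|) ≤ 1) :
    t / 4 * ∑ i, condVar B₀ B θ i (fun u => ∑ k, Δ i k * pairFun B₀ B i k u (x k)) x
      ≤ excess B₀ B θ Δ x := by
  rw [Finset.mul_sum]
  exact Finset.sum_le_sum fun j _ => variance_le_log_sum_exp (fun u => (condProb_pos θ j u x).le)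
    (sum_condProb θ j x) (sum_condProb_mul_localField_sub θ Δ j x)
    (fun u => abs_localField_sub_meanField_le hB θ Δ j u x) ht ht1 (htR j)

/-- The first order expansion of `φ(·, x)`. -/
lemma phi_add (θ Δ : Matrix (Fin p) (Fin p) ℝ) (x : Fin p → 𝒳) :
    phi B₀ B (θ + Δ) x = phi B₀ B θ x + excess B₀ B θ Δ x
      - ∑ j, ∑ k, Δ j k * score B₀ B θ j k x := by
  simp only [phi, excess, ← Finset.sum_neg_distrib, ← Finset.sum_add_distrib,
    ← Finset.sum_sub_distrib]
  refine Finset.sum_congr rfl fun j _ => ?_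
  have hlog : ∀ θ : Matrix (Fin p) (Fin p) ℝ, Real.log (condProb B₀ B θ j (x j) x)
      = localField B₀ B θ j (x j) x - Real.log (∑ z, Real.exp (localField B₀ B θ j z x)) :=
    fun θ => by
      rw [condProb, Real.log_div (Real.exp_pos _).ne' (sum_exp_localField_pos θ j x).ne',
        Real.log_exp]
  -- The partition function at `θ + Δ` is the one at `θ` times the conditional exponential moment of
  -- the field of `Δ`. Splitting off the mean of that field leaves exactly the summand of `excess`.
  have hsum : ∑ z, Real.exp (localField B₀ B (θ + Δ) j z x)
      = (∑ z, Real.exp (localField B₀ B θ j z x)) * (Real.exp (meanField B₀ B θ Δ j x) *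
        ∑ u, condProb B₀ B θ j u x *
          Real.exp (localField B₀ B Δ j u x - meanField B₀ B θ Δ j x)) := by
    rw [Finset.mul_sum, Finset.mul_sum]
    refine Finset.sum_congr rfl fun z _ => ?_
    rw [localField_add, Real.exp_add, Real.exp_sub, condProb]
    field_simp [(sum_exp_localField_pos (B₀ := B₀) (B := B) θ j x).ne']
  have hpos : 0 < ∑ u, condProb B₀ B θ j u x *
      Real.exp (localField B₀ B Δ j u x - meanField B₀ B θ Δ j x) :=
    zero_lt_one.trans_le (one_le_sum_exp (fun u => (condProb_pos θ j u x).le)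
      (sum_condProb θ j x) (sum_condProb_mul_localField_sub θ Δ j x))
  have hscore : ∑ k, Δ j k * score B₀ B θ j k x
      = localField B₀ B Δ j (x j) x - meanField B₀ B θ Δ j x := by
    simp only [score, mul_sub, Finset.sum_sub_distrib, meanField_eq, localField]
  rw [hlog, hlog, hsum, Real.log_mul (sum_exp_localField_pos θ j x).ne' (by positivity),
    Real.log_mul (Real.exp_pos _).ne' hpos.ne', Real.log_exp, hscore, localField_add]
  ring

lemma abs_phi_sub_le (hB : ∀ u v, B u v = B v u) (θ θ' : Matrix (Fin p) (Fin p) ℝ)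
    (x : Fin p → 𝒳) :
    |phi B₀ B θ' x - phi B₀ B θ x| ≤ fluct B₀ B * ∑ j, ∑ k, |(θ' - θ) j k| := by
  have key : ∀ θ θ' : Matrix (Fin p) (Fin p) ℝ, ∀ j : Fin p,
      Real.log (condProb B₀ B θ' j (x j) x) - Real.log (condProb B₀ B θ j (x j) x)
        ≤ fluct B₀ B * ∑ k, |(θ' - θ) j k| := fun θ θ' j => by
    have := Real.log_le_log (condProb_pos θ' j (x j) x)
      (condProb_le_exp_mul (B₀ := B₀) hB θ θ' j (x j) x)
    rw [Real.log_mul (Real.exp_pos _).ne' (condProb_pos θ j (x j) x).ne', Real.log_exp] at this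
    linarith
  simp only [phi]
  rw [neg_sub_neg, ← Finset.sum_sub_distrib, Finset.mul_sum]
  refine (Finset.abs_sum_le_sum_abs _ _).trans (Finset.sum_le_sum fun j _ => abs_le.2 ⟨?_, ?_⟩)
  · linarith [key θ θ' j]
  · refine (key θ' θ j).trans (le_of_eq ?_)
    simp only [Matrix.sub_apply, abs_sub_comm]

/-- The mean under `g_θ` of the score at `θ'`. -/
lemma abs_expect_score_le [Nonempty 𝒳] (hB : ∀ u v, B u v = B v u) (hθ : θ.IsSymm)
    (θ' : Matrix (Fin p) (Fin p) ℝ) (j k : Fin p) :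
    |expect B₀ B θ (score B₀ B θ' j k)|
      ≤ fluct B₀ B * (fluct B₀ B * ∑ k, |(θ - θ') j k|) := by
  -- Given the other coordinates, the mean score is a difference of conditional means under `θ` and
  -- `θ'`, controlled by the ratio of the two conditional laws.
  rw [← expect_condProb hB hθ j]
  refine abs_expect_le fun x => ?_
  have : ∑ u, condProb B₀ B θ j u x * score B₀ B θ' j k (Function.update x j u)
      = ∑ u, condProb B₀ B θ j u x * pairFun B₀ B j k u (x k)
        - ∑ u, condProb B₀ B θ' j u x * pairFun B₀ B j k u (x k) := by
    simp only [score, pairFun_update, condProb_update, Function.update_self, mul_sub,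
      Finset.sum_sub_distrib, ← Finset.sum_mul, sum_condProb, one_mul]
  rw [this, abs_sub_comm]
  exact abs_mean_sub_mean_le (fun u => (condProb_pos θ j u x).le) (sum_condProb θ' j x)
    (sum_condProb θ j x) (fluct_nonneg B₀ B) (fun u v => abs_pairFun_sub_le hB _ _ _ _ _)
    fun u => condProb_le_exp_mul hB θ' θ j u x

lemma expect_score [Nonempty 𝒳] (hB : ∀ u v, B u v = B v u) (hθ : θ.IsSymm) (j k : Fin p) :
    expect B₀ B θ (score B₀ B θ j k) = 0 := by
  have := abs_expect_score_le (B₀ := B₀) hB hθ θ j k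
  simpa using this

/-- The linear term of the expansion is a score at the true parameter, of mean zero, so only the
excess, quadratic in the row sums, survives. -/
lemma expect_phi_sub_le [Nonempty 𝒳] (hB : ∀ u v, B u v = B v u) (hθ : θ.IsSymm)
    (θ' : Matrix (Fin p) (Fin p) ℝ) :
    expect B₀ B θ (fun x => phi B₀ B θ' x - phi B₀ B θ x)
      ≤ ∑ j, (fluct B₀ B * ∑ k, |(θ' - θ) j k|) ^ 2 := by
  have e : ∀ x, phi B₀ B θ' x - phi B₀ B θ x = excess B₀ B θ (θ' - θ) x
      - ∑ j, ∑ k, (θ' - θ) j k * score B₀ B θ j k x := fun x => by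
    have := phi_add (B₀ := B₀) (B := B) θ (θ' - θ) x
    rw [add_sub_cancel] at this
    linarith
  simp only [e]
  rw [expect_sub]
  simp only [expect_sum, expect_mul_left, expect_score hB hθ, mul_zero, Finset.sum_const_zero,
    sub_zero]
  rw [← expect_const (B₀ := B₀) (B := B) θ (∑ j, (fluct B₀ B * ∑ k, |(θ' - θ) j k|) ^ 2)]
  exact expect_mono fun x => excess_le hB θ _ x

end ModelLemmas

/-! ### Norms, supports and row sums of symmetric matrices -/

section Norms

variable {p : ℕ} {θ Δ : Matrix (Fin p) (Fin p) ℝ}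

lemma mem_coords {e : Fin p × Fin p} : e ∈ coords p ↔ e.2 ≤ e.1 := by simp [coords]

lemma supp_subset (θ : Matrix (Fin p) (Fin p) ℝ) : supp θ ⊆ coords p := Finset.filter_subset _ _

lemma normOne_nonneg (θ : Matrix (Fin p) (Fin p) ℝ) : 0 ≤ normOne θ :=
  Finset.sum_nonneg fun _ _ => abs_nonneg _

lemma normTwoSq_nonneg (θ : Matrix (Fin p) (Fin p) ℝ) : 0 ≤ normTwoSq θ :=
  Finset.sum_nonneg fun _ _ => sq_nonneg _

lemma normOne_eq_add (θ Δ : Matrix (Fin p) (Fin p) ℝ) :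
    normOne Δ = ∑ e ∈ coords p \ supp θ, |Δ e.1 e.2| + ∑ e ∈ supp θ, |Δ e.1 e.2| :=
  (Finset.sum_sdiff (supp_subset θ)).symm

lemma sum_row_le_normOne (hΔ : Δ.IsSymm) (j : Fin p) : ∑ k, |Δ j k| ≤ normOne Δ := by
  classical
  have hinj : Function.Injective fun k : Fin p => (max j k, min j k) := by
    intro k l h
    simp only [Prod.mk.injEq] at h
    obtain ⟨h1, h2⟩ := h
    rcases le_total j k with hk | hk <;> rcases le_total j l with hl | hl <;>
      simp only [hk, hl, max_eq_left, max_eq_right, min_eq_left, min_eq_right] at h1 h2 <;> order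
  have hval : ∀ k, |Δ j k| = |Δ (max j k) (min j k)| := fun k => by
    rcases le_total j k with hk | hk
    · rw [max_eq_right hk, min_eq_left hk, hΔ.apply]
    · rw [max_eq_left hk, min_eq_right hk]
  calc ∑ k, |Δ j k| = ∑ e ∈ Finset.univ.image fun k : Fin p => (max j k, min j k),
        |Δ e.1 e.2| := by
        rw [Finset.sum_image fun _ _ _ _ h => hinj h]
        exact Finset.sum_congr rfl fun k _ => hval k
    _ ≤ normOne Δ := Finset.sum_le_sum_of_subset_of_nonneg
        (fun e he => by
          obtain ⟨k, -, rfl⟩ := Finset.mem_image.1 he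
          exact mem_coords.2 min_le_max) fun _ _ _ => abs_nonneg _

lemma sum_sum_abs_le (hΔ : Δ.IsSymm) : ∑ j, ∑ k, |Δ j k| ≤ 2 * normOne Δ := by
  have h : ∀ j k : Fin p, |Δ j k| ≤ (if k ≤ j then |Δ j k| else 0)
      + (if j ≤ k then |Δ k j| else 0) := fun j k => by
    rcases le_total k j with h | h
    · rw [if_pos h]
      have : 0 ≤ if j ≤ k then |Δ k j| else 0 := by split_ifs <;> positivity
      linarith
    · have : 0 ≤ if k ≤ j then |Δ j k| else 0 := by split_ifs <;> positivity
      rw [if_pos h, hΔ.apply j k]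
      linarith
  have e : normOne Δ = ∑ j, ∑ k, if k ≤ j then |Δ j k| else 0 := by
    rw [normOne, coords, Finset.sum_filter, Fintype.sum_prod_type]
  calc ∑ j, ∑ k, |Δ j k| ≤ ∑ j, ∑ k, ((if k ≤ j then |Δ j k| else 0)
        + (if j ≤ k then |Δ k j| else 0)) :=
        Finset.sum_le_sum fun j _ => Finset.sum_le_sum fun k _ => h j k
    _ = 2 * normOne Δ := by
        simp only [Finset.sum_add_distrib]
        rw [Finset.sum_comm (f := fun j k => if j ≤ k then |Δ k j| else 0), ← e]
        ring

/-- One factor of each square is at most `‖Δ‖₁`; the remaining row sums add up to at most `2 ‖Δ‖₁`,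
since an off-diagonal coordinate lies in two rows. -/
lemma sum_row_sq_le (hΔ : Δ.IsSymm) : ∑ j, (∑ k, |Δ j k|) ^ 2 ≤ 2 * normOne Δ ^ 2 :=
  calc ∑ j, (∑ k, |Δ j k|) ^ 2 ≤ ∑ j, normOne Δ * ∑ k, |Δ j k| :=
        Finset.sum_le_sum fun j _ => by
          rw [sq]
          exact mul_le_mul_of_nonneg_right (sum_row_le_normOne hΔ j)
            (Finset.sum_nonneg fun _ _ => abs_nonneg _)
    _ = normOne Δ * ∑ j, ∑ k, |Δ j k| := by rw [Finset.mul_sum]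
    _ ≤ normOne Δ * (2 * normOne Δ) :=
        mul_le_mul_of_nonneg_left (sum_sum_abs_le hΔ) (normOne_nonneg Δ)
    _ = 2 * normOne Δ ^ 2 := by ring

lemma sq_sum_supp_le (θ Δ : Matrix (Fin p) (Fin p) ℝ) :
    (∑ e ∈ supp θ, |Δ e.1 e.2|) ^ 2 ≤ sparsity θ * normTwoSq Δ := by
  refine sq_sum_le_card_mul_sum_sq.trans ?_
  refine mul_le_mul_of_nonneg_left ?_ (Nat.cast_nonneg _)
  simp only [sq_abs]
  exact Finset.sum_le_sum_of_subset_of_nonneg (supp_subset θ) fun _ _ _ => sq_nonneg _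

lemma normOne_eq_sum_supp (θ : Matrix (Fin p) (Fin p) ℝ) :
    normOne θ = ∑ e ∈ supp θ, |θ e.1 e.2| := by
  rw [normOne_eq_add θ θ, add_eq_right]
  refine Finset.sum_eq_zero fun e he => ?_
  rw [Finset.mem_sdiff, supp, Finset.mem_filter, not_and] at he
  rw [not_not.1 (he.2 he.1), abs_zero]

lemma normOne_sq_le (θ : Matrix (Fin p) (Fin p) ℝ) :
    normOne θ ^ 2 ≤ sparsity θ * normTwoSq θ := by
  rw [normOne_eq_sum_supp]
  exact sq_sum_supp_le θ θ

/-- Off the support of `θ` a perturbation adds all its mass, on the support it removes at most its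
mass. This is how the penalty confines the error to the cone. -/
lemma normOne_add_ge (θ Δ : Matrix (Fin p) (Fin p) ℝ) :
    normOne θ + ∑ e ∈ coords p \ supp θ, |Δ e.1 e.2| - ∑ e ∈ supp θ, |Δ e.1 e.2|
      ≤ normOne (θ + Δ) := by
  rw [normOne_eq_add θ (θ + Δ), normOne_eq_sum_supp θ]
  have h1 : ∑ e ∈ coords p \ supp θ, |Δ e.1 e.2|
      = ∑ e ∈ coords p \ supp θ, |(θ + Δ) e.1 e.2| := by
    refine Finset.sum_congr rfl fun e he => ?_
    rw [Finset.mem_sdiff, supp, Finset.mem_filter, not_and] at he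
    rw [Matrix.add_apply, not_not.1 (he.2 he.1), zero_add]
  have h2 : ∑ e ∈ supp θ, |θ e.1 e.2| - ∑ e ∈ supp θ, |Δ e.1 e.2|
      ≤ ∑ e ∈ supp θ, |(θ + Δ) e.1 e.2| := by
    rw [← Finset.sum_sub_distrib]
    refine Finset.sum_le_sum fun e _ => ?_
    have := abs_sub_abs_le_abs_sub (θ e.1 e.2) (-Δ e.1 e.2)
    rwa [abs_neg, sub_neg_eq_add] at this
  linarith

lemma sum_row_le_rowGap (θ₁ θ₂ : Matrix (Fin p) (Fin p) ℝ) (j : Fin p) :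
    ∑ k, |(θ₂ - θ₁) j k| ≤ rowGap θ₁ θ₂ :=
  le_ciSup (f := fun j : Fin p => ∑ k : Fin p, |θ₂ j k - θ₁ j k|)
    (Set.finite_range _).bddAbove j

lemma rowGap_nonneg (θ₁ θ₂ : Matrix (Fin p) (Fin p) ℝ) : 0 ≤ rowGap θ₁ θ₂ :=
  Real.iSup_nonneg fun _ => Finset.sum_nonneg fun _ _ => abs_nonneg _

/-- Each non-zero coordinate touches at most two rows, so at most `2 s` rows contribute; the bound
thus involves `s` rather than `p`. -/
lemma sum_row_sq_le_rowGap {θ₁ θ₂ : Matrix (Fin p) (Fin p) ℝ} (h₁ : θ₁.IsSymm)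
    (h₂ : θ₂.IsSymm) :
    ∑ j, (∑ k, |(θ₂ - θ₁) j k|) ^ 2 ≤ 2 * sparsity (θ₂ - θ₁) * rowGap θ₁ θ₂ ^ 2 := by
  classical
  set A := supp (θ₂ - θ₁)
  have hsymm : (θ₂ - θ₁).IsSymm := h₂.sub h₁
  set V := A.image Prod.fst ∪ A.image Prod.snd
  have hV : (V.card : ℝ) ≤ 2 * sparsity (θ₂ - θ₁) := by
    have : V.card ≤ 2 * A.card :=
      (Finset.card_union_le _ _).trans
        (by linarith [Finset.card_image_le (s := A) (f := Prod.fst),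
          Finset.card_image_le (s := A) (f := Prod.snd)])
    exact_mod_cast this
  have h0 : ∀ j, j ∉ V → (∑ k, |(θ₂ - θ₁) j k|) ^ 2 = 0 := fun j hj => by
    rw [sq_eq_zero_iff]
    refine Finset.sum_eq_zero fun k _ => ?_
    by_contra hne
    rw [abs_eq_zero] at hne
    refine hj ?_
    rcases le_total k j with h | h
    · exact Finset.mem_union_left _ (Finset.mem_image.2
        ⟨(j, k), Finset.mem_filter.2 ⟨mem_coords.2 h, hne⟩, rfl⟩)
    · rw [← hsymm.apply] at hne
      exact Finset.mem_union_right _ (Finset.mem_image.2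
        ⟨(k, j), Finset.mem_filter.2 ⟨mem_coords.2 h, hne⟩, rfl⟩)
  rw [← Finset.sum_subset (Finset.subset_univ V) fun j _ hj => h0 j hj]
  calc ∑ j ∈ V, (∑ k, |(θ₂ - θ₁) j k|) ^ 2 ≤ ∑ j ∈ V, rowGap θ₁ θ₂ ^ 2 :=
        Finset.sum_le_sum fun j _ => pow_le_pow_left₀
          (Finset.sum_nonneg fun _ _ => abs_nonneg _) (sum_row_le_rowGap θ₁ θ₂ j) 2
    _ = V.card * rowGap θ₁ θ₂ ^ 2 := by rw [Finset.sum_const, nsmul_eq_mul]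
    _ ≤ _ := mul_le_mul_of_nonneg_right hV (sq_nonneg _)

lemma sparsity_sub_le (θ₁ θ₂ : Matrix (Fin p) (Fin p) ℝ) :
    sparsity (θ₂ - θ₁) ≤ sparsity θ₁ + sparsity θ₂ := by
  classical
  refine (Finset.card_le_card fun e he => ?_).trans (Finset.card_union_le (supp θ₁) (supp θ₂))
  obtain ⟨h1, h2⟩ := Finset.mem_filter.1 he
  by_contra hcon
  simp only [supp, Finset.mem_union, Finset.mem_filter, h1, true_and, not_or, not_not] at hcon
  exact h2 (by rw [Matrix.sub_apply, hcon.1, hcon.2, sub_zero])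

lemma normTwoSq_sub_pos {θ₁ θ₂ : Matrix (Fin p) (Fin p) ℝ} (h₁ : θ₁.IsSymm)
    (h₂ : θ₂.IsSymm) (h : θ₁ ≠ θ₂) : 0 < normTwoSq (θ₂ - θ₁) := by
  refine (normTwoSq_nonneg _).lt_of_ne fun h0 => h ?_
  rw [normTwoSq, eq_comm, Finset.sum_eq_zero_iff_of_nonneg fun _ _ => sq_nonneg _] at h0
  have key : ∀ j k : Fin p, k ≤ j → θ₁ j k = θ₂ j k := fun j k hk => by
    have := h0 (j, k) (mem_coords.2 hk)
    rw [sq_eq_zero_iff, Matrix.sub_apply, sub_eq_zero] at this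
    exact this.symm
  ext j k
  rcases le_total k j with hk | hk
  · exact key j k hk
  · rw [← h₁.apply, ← h₂.apply]
    exact key k j hk

end Norms

/-! ### The deterministic oracle inequality -/

section Oracle

variable {p : ℕ} {𝒳 : Type*} [Fintype 𝒳] {B₀ : 𝒳 → ℝ} {B : 𝒳 → 𝒳 → ℝ}
  {θ Δ : Matrix (Fin p) (Fin p) ℝ}

/-- The quadratic form `∑_i Var(∑_k Δ_ik B_ik(X_i, x_k) | x_{-i})`. -/
noncomputable def quadForm (B₀ : 𝒳 → ℝ) (B : 𝒳 → 𝒳 → ℝ) (θ Δ : Matrix (Fin p) (Fin p) ℝ)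
    (x : Fin p → 𝒳) : ℝ :=
  ∑ i, condVar B₀ B θ i (fun u => ∑ k, Δ i k * pairFun B₀ B i k u (x k)) x

lemma quadForm_eq (θ Δ : Matrix (Fin p) (Fin p) ℝ) (x : Fin p → 𝒳) :
    quadForm B₀ B θ Δ x = ∑ i, ∑ k, ∑ l, Δ i k * Δ i l * condCov B₀ B θ i k l x := by
  simp only [quadForm, condVar_eq]

lemma abs_sum_mul_mul_le {C : Fin p → Fin p → Fin p → ℝ} {η : ℝ} (hη : 0 ≤ η)
    (hΔ : Δ.IsSymm) (hC : ∀ i k l, |C i k l| ≤ η) :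
    |∑ i, ∑ k, ∑ l, Δ i k * Δ i l * C i k l| ≤ η * (2 * normOne Δ ^ 2) := by
  calc |∑ i, ∑ k, ∑ l, Δ i k * Δ i l * C i k l|
      ≤ ∑ i, ∑ k, ∑ l, |Δ i k| * |Δ i l| * η := by
        refine (Finset.abs_sum_le_sum_abs _ _).trans (Finset.sum_le_sum fun i _ => ?_)
        refine (Finset.abs_sum_le_sum_abs _ _).trans (Finset.sum_le_sum fun k _ => ?_)
        refine (Finset.abs_sum_le_sum_abs _ _).trans (Finset.sum_le_sum fun l _ => ?_)
        rw [abs_mul, abs_mul]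
        exact mul_le_mul_of_nonneg_left (hC i k l) (by positivity)
    _ = η * ∑ i, (∑ k, |Δ i k|) ^ 2 := by
        simp only [← Finset.sum_mul, sq, Finset.sum_mul_sum, mul_comm η]
    _ ≤ _ := mul_le_mul_of_nonneg_left (sum_row_sq_le hΔ) hη

lemma rsc_le_expect {ρ : ℝ} (hρ : RestrictedStrongConvexity B₀ B θ ρ) (hΔ : Δ ∈ cone θ) :
    2 * ρ * normTwoSq Δ ≤ expect B₀ B θ (quadForm B₀ B θ Δ) := by
  refine (hρ.2 Δ hΔ).trans (le_of_eq ?_)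
  rw [← expect_sum]
  rfl

/-- The restricted strong convexity constant is at most `c₀²` unless the parameter vanishes. -/
lemma sparsity_le [Nonempty 𝒳] (hB : ∀ u v, B u v = B v u) {ρ : ℝ}
    (hρ : RestrictedStrongConvexity B₀ B θ ρ) :
    (sparsity θ : ℝ) ≤ fluct B₀ B ^ 2 * (sparsity θ / ρ) := by
  classical
  have hρ0 := hρ.1
  rcases (supp θ).eq_empty_or_nonempty with h0 | ⟨e, he⟩
  · simp [sparsity, h0]
  suffices ρ ≤ fluct B₀ B ^ 2 by
    rw [← mul_div_assoc, le_div_iff₀ hρ0, mul_comm]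
    exact mul_le_mul_of_nonneg_right this (Nat.cast_nonneg _)
  -- Restricted strong convexity is tested on the symmetric unit perturbation at one support
  -- coordinate: it lies in the cone, both its norms are one, and its quadratic form is at most `2
  -- c₀²`.
  let Δ : Matrix (Fin p) (Fin p) ℝ := fun a b => if (a, b) = e ∨ (b, a) = e then 1 else 0
  have hsymm : Δ.IsSymm := by
    ext a b
    change (if (b, a) = e ∨ (a, b) = e then (1 : ℝ) else 0) = _
    simp only [Δ, or_comm]
  have hval : ∀ f ∈ coords p, Δ f.1 f.2 = if f = e then 1 else 0 := fun f hf => by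
    have hf := mem_coords.1 hf
    have hec := mem_coords.1 (supp_subset θ he)
    have : ((f.1, f.2) = e ∨ (f.2, f.1) = e) ↔ f = e := by
      refine ⟨fun h => h.elim id fun h => ?_, fun h => Or.inl h⟩
      rw [← h] at hec ⊢
      have := le_antisymm hf hec
      ext <;> simp [this]
    simp only [Δ, this]
  have hone : normOne Δ = 1 := by
    rw [normOne, Finset.sum_congr rfl fun f hf => by rw [hval f hf]]
    simp [apply_ite abs, supp_subset θ he]
  have htwo : normTwoSq Δ = 1 := by
    rw [normTwoSq, Finset.sum_congr rfl fun f hf => by rw [hval f hf]]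
    simp [supp_subset θ he]
  have hcone : Δ ∈ cone θ := by
    refine ⟨hsymm, ?_⟩
    have : ∑ f ∈ coords p \ supp θ, |Δ f.1 f.2| = 0 := Finset.sum_eq_zero fun f hf => by
      rw [Finset.mem_sdiff] at hf
      rw [hval f hf.1, if_neg (by rintro rfl; exact hf.2 he), abs_zero]
    rw [this]
    exact mul_nonneg (by norm_num) (Finset.sum_nonneg fun _ _ => abs_nonneg _)
  have h1 := rsc_le_expect hρ hcone
  have h2 : |expect B₀ B θ (quadForm B₀ B θ Δ)| ≤ fluct B₀ B ^ 2 * (2 * normOne Δ ^ 2) :=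
    abs_expect_le fun x => by
      rw [quadForm_eq]
      exact abs_sum_mul_mul_le (sq_nonneg _) hsymm fun i k l => abs_condCov_le hB θ i k l x
  rw [hone] at h2
  rw [htwo] at h1
  linarith [(abs_le.1 h2).2]

/-- Empirical restricted strong convexity from entrywise concentration. -/
lemma le_sum_quadForm {ρ : ℝ} {J : Finset ℕ} {x : ℕ → Fin p → 𝒳}
    (hρ : RestrictedStrongConvexity B₀ B θ ρ) (hs : 0 < sparsity θ)
    (hdev : ∀ i k l, sparsity θ * |∑ t ∈ J, (condCov B₀ B θ i k l (x t)
      - expect B₀ B θ (condCov B₀ B θ i k l))| ≤ ρ * J.card / 64)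
    (hΔ : Δ ∈ cone θ) :
    ρ * J.card * normTwoSq Δ ≤ ∑ t ∈ J, quadForm B₀ B θ Δ (x t) := by
  have hs' : (0 : ℝ) < sparsity θ := by exact_mod_cast hs
  have hρ0 := hρ.1
  set dev : Fin p → Fin p → Fin p → ℝ := fun i k l => ∑ t ∈ J, (condCov B₀ B θ i k l (x t)
      - expect B₀ B θ (condCov B₀ B θ i k l)) with hdevdef
  have e1 : ∑ t ∈ J, quadForm B₀ B θ Δ (x t)
      = J.card * expect B₀ B θ (quadForm B₀ B θ Δ)
        + ∑ i, ∑ k, ∑ l, Δ i k * Δ i l * dev i k l := by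
    have hE : expect B₀ B θ (quadForm B₀ B θ Δ)
        = ∑ i, ∑ k, ∑ l, Δ i k * Δ i l * expect B₀ B θ (condCov B₀ B θ i k l) := by
      have : quadForm B₀ B θ Δ
          = fun x => ∑ i, ∑ k, ∑ l, Δ i k * Δ i l * condCov B₀ B θ i k l x :=
        funext fun x => quadForm_eq θ Δ x
      rw [this]
      simp only [expect_sum, expect_mul_left]
    have hS : ∑ t ∈ J, quadForm B₀ B θ Δ (x t)
        = ∑ i, ∑ k, ∑ l, Δ i k * Δ i l * ∑ t ∈ J, condCov B₀ B θ i k l (x t) := by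
      simp only [quadForm_eq, Finset.mul_sum]
      rw [Finset.sum_comm]
      refine Finset.sum_congr rfl fun i _ => ?_
      rw [Finset.sum_comm]
      refine Finset.sum_congr rfl fun k _ => ?_
      rw [Finset.sum_comm]
    rw [hE, hS, Finset.mul_sum, ← Finset.sum_add_distrib]
    refine Finset.sum_congr rfl fun i _ => ?_
    rw [Finset.mul_sum, ← Finset.sum_add_distrib]
    refine Finset.sum_congr rfl fun k _ => ?_
    rw [Finset.mul_sum, ← Finset.sum_add_distrib]
    refine Finset.sum_congr rfl fun l _ => ?_
    simp only [hdevdef, Finset.sum_sub_distrib, Finset.sum_const, nsmul_eq_mul]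
    ring
  have h2 := abs_sum_mul_mul_le (C := dev) (η := ρ * J.card / 64 / sparsity θ) (by positivity)
    hΔ.1 fun i k l => by
      rw [le_div_iff₀ hs', mul_comm]
      exact hdev i k l
  -- In the cone `‖Δ‖₁` is at most four times the mass on the support. With accuracy `ρ / (64 s)`
  -- per observation, the deviation then costs `ρ |J| ‖Δ‖₂² / 2` out of the available `2 ρ |J|
  -- ‖Δ‖₂²`.
  have h3 : normOne Δ ^ 2 ≤ 16 * (sparsity θ * normTwoSq Δ) := by
    have hle : normOne Δ ≤ 4 * ∑ e ∈ supp θ, |Δ e.1 e.2| := by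
      rw [normOne_eq_add θ Δ]
      linarith [hΔ.2]
    have := pow_le_pow_left₀ (normOne_nonneg Δ) hle 2
    nlinarith [sq_sum_supp_le θ Δ]
  have h4 : ρ * J.card / 64 / sparsity θ * (2 * normOne Δ ^ 2)
      ≤ ρ * J.card * normTwoSq Δ / 2 := by
    calc _ ≤ ρ * J.card / 64 / sparsity θ * (2 * (16 * (sparsity θ * normTwoSq Δ))) := by gcongr
      _ = _ := by field_simp; ring
  have h5 := mul_le_mul_of_nonneg_left (rsc_le_expect hρ hΔ) (Nat.cast_nonneg (α := ℝ) J.card)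
  have h6 : 0 ≤ ρ * J.card * normTwoSq Δ :=
    mul_nonneg (by positivity) (normTwoSq_nonneg Δ)
  rw [e1]
  linarith [(abs_le.1 h2).1]

/-- Here `A` and `C` are the masses of the error on and off the support, and `q` is the noise level.
If `c (C + A) ≤ 1`, then `t = 1` gives the rate. Otherwise `t = 1 / (c (C + A))` and `C + A ≤ 4 A`
give `ρ n ≤ 1344 q s c`, which contradicts the sample size because `1344 < 1536`. -/
lemma mul_le_of_localized_curvature {c ρ L s n q A C : ℝ} (hc : 0 < c) (hρ : 0 < ρ)
    (hL : 0 < L) (hs : 0 < s) (hn0 : 0 < n) (hq0 : 0 < q) (hA1 : 0 < A) (hC0 : 0 ≤ C)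
    (hCA : C ≤ 3 * A) (hq2 : q ^ 2 = c ^ 2 * (n * L))
    (hn : 1536 ^ 2 * (c ^ 2 * (s / ρ)) ^ 2 * L ≤ n)
    (hDlow : ∀ t : ℝ, 0 < t → t ≤ 1 → t * (c * (C + A)) ≤ 1 →
      t * (ρ * n * A) ≤ 336 * q * s) :
    q * A ≤ 336 * (c ^ 2 * (s / ρ)) * L := by
  have hcA : 0 < c * (C + A) := by positivity
  by_cases hsmall : c * (C + A) ≤ 1
  · have h1 := hDlow 1 one_pos le_rfl (by linarith)
    have h2 : q * A * (ρ * n) ≤ 336 * (c ^ 2 * (s / ρ)) * L * (ρ * n) := by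
      have e : 336 * (c ^ 2 * (s / ρ)) * L * (ρ * n) = 336 * s * (c ^ 2 * (n * L)) := by
        field_simp
      rw [e, ← hq2]
      have := mul_le_mul_of_nonneg_left h1 hq0.le
      linarith
    exact le_of_mul_le_mul_right h2 (by positivity)
  · exfalso
    push Not at hsmall
    have h1 := hDlow (1 / (c * (C + A))) (by positivity)
      ((div_le_one hcA).2 hsmall.le) (by rw [one_div_mul_cancel hcA.ne'])
    have h2 : ρ * n ≤ 1344 * q * s * c := by
      have h3 : ρ * n * A ≤ 336 * q * s * (c * (C + A)) := by
        rwa [one_div_mul_eq_div, div_le_iff₀ hcA] at h1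
      have h4 : 336 * q * s * (c * (C + A)) ≤ 1344 * q * s * c * A := by
        have : 336 * q * s * c * (C + A) ≤ 336 * q * s * c * (4 * A) :=
          mul_le_mul_of_nonneg_left (by linarith) (by positivity)
        linarith
      exact le_of_mul_le_mul_right (h3.trans h4) hA1
    have h3 : (ρ * n) ^ 2 ≤ 1344 ^ 2 * (c ^ 4 * s ^ 2 * L) * n := by
      have := pow_le_pow_left₀ (by positivity) h2 2
      have e : (1344 * q * s * c) ^ 2 = 1344 ^ 2 * s ^ 2 * c ^ 2 * q ^ 2 := by ring
      rw [e, hq2] at this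
      linarith
    have h4 : 1536 ^ 2 * (c ^ 4 * s ^ 2 * L) * n ≤ (ρ * n) ^ 2 := by
      have := mul_le_mul_of_nonneg_right hn (by positivity : 0 ≤ ρ ^ 2 * n)
      have e : 1536 ^ 2 * (c ^ 2 * (s / ρ)) ^ 2 * L * (ρ ^ 2 * n)
          = 1536 ^ 2 * (c ^ 4 * s ^ 2 * L) * n := by field_simp
      rw [e] at this
      linarith
    have h5 : 0 < c ^ 4 * s ^ 2 * L * n := by positivity
    linarith

/-- The deterministic oracle inequality: on a segment `I` at least half of which is made of
observations `J` that satisfy restricted strong convexity at `θ`, the penalized estimate has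
nearly the same empirical loss as `θ`. -/
lemma abs_sum_phi_sub_le {ρ L : ℝ} {I J : Finset ℕ} {x : ℕ → Fin p → 𝒳}
    {θhat : Matrix (Fin p) (Fin p) ℝ} {T : ℕ} (hB : ∀ u v, B u v = B v u)
    (hT : 0 < T) (hL : 0 < L) (hc : 0 < fluct B₀ B) (hρ : 0 < ρ) (hθ : θ.IsSymm)
    (hJI : J ⊆ I) (hJ : (I.card : ℝ) ≤ 2 * J.card)
    (hn : 1536 ^ 2 * (fluct B₀ B ^ 2 * (sparsity θ / ρ)) ^ 2 * L ≤ I.card)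
    (hscore : ∀ j k, |∑ t ∈ I, score B₀ B θ j k (x t)|
      ≤ 5 * (fluct B₀ B * √(I.card * L)))
    (hquad : 0 < sparsity θ → ∀ Δ ∈ cone θ,
      ρ * J.card * normTwoSq Δ ≤ ∑ t ∈ J, quadForm B₀ B θ Δ (x t))
    (hmin : IsPenalizedMinimizer B₀ B T I x (32 * fluct B₀ B * √(I.card * L) / T) θhat) :
    |∑ t ∈ I, phi B₀ B θhat (x t) - ∑ t ∈ I, phi B₀ B θ (x t)|
      ≤ 13440 * (fluct B₀ B ^ 2 * (sparsity θ / ρ)) * L := by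
  set c := fluct B₀ B with hcdef
  set s : ℝ := (sparsity θ : ℝ) with hsdef
  have hs0 : 0 ≤ s := Nat.cast_nonneg _
  have hrhs : 0 ≤ 13440 * (c ^ 2 * (s / ρ)) * L := by positivity
  rcases I.eq_empty_or_nonempty with rfl | hI
  · simpa using hrhs
  set n : ℝ := (I.card : ℝ) with hndef
  have hn0 : 0 < n := Nat.cast_pos.2 hI.card_pos
  set q := c * √(n * L) with hq
  have hq0 : 0 < q := mul_pos hc (Real.sqrt_pos.2 (mul_pos hn0 hL))
  have hq2 : q ^ 2 = c ^ 2 * (n * L) := by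
    rw [hq, mul_pow, Real.sq_sqrt (mul_pos hn0 hL).le]
  obtain ⟨Δ, rfl⟩ : ∃ Δ, θhat = θ + Δ := ⟨θhat - θ, by abel⟩
  have hΔ : Δ.IsSymm := by
    have := hmin.1.sub hθ
    rwa [add_sub_cancel_left] at this
  set A := ∑ e ∈ supp θ, |Δ e.1 e.2| with hA
  set C := ∑ e ∈ coords p \ supp θ, |Δ e.1 e.2| with hC
  have hA0 : 0 ≤ A := Finset.sum_nonneg fun _ _ => abs_nonneg _
  have hC0 : 0 ≤ C := Finset.sum_nonneg fun _ _ => abs_nonneg _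
  have hy : normOne Δ = C + A := normOne_eq_add θ Δ
  set D := ∑ t ∈ I, excess B₀ B θ Δ (x t) with hD
  have hD0 : 0 ≤ D := Finset.sum_nonneg fun _ _ => excess_nonneg _ _ _
  set lin := ∑ j, ∑ k, Δ j k * ∑ t ∈ I, score B₀ B θ j k (x t) with hlin
  have hdiff : ∑ t ∈ I, phi B₀ B (θ + Δ) (x t) - ∑ t ∈ I, phi B₀ B θ (x t) = D - lin := by
    have e : lin = ∑ t ∈ I, ∑ j, ∑ k, Δ j k * score B₀ B θ j k (x t) := by
      simp only [hlin, Finset.mul_sum]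
      rw [Finset.sum_comm]
      rw [Finset.sum_congr rfl fun k _ => Finset.sum_comm]
      rw [Finset.sum_comm]
      exact Finset.sum_congr rfl fun t _ => Finset.sum_comm
    rw [e, hD, ← Finset.sum_sub_distrib, ← Finset.sum_sub_distrib]
    refine Finset.sum_congr rfl fun t _ => ?_
    rw [phi_add]; ring
  have hlin' : |lin| ≤ 10 * q * (C + A) := by
    calc |lin| ≤ ∑ j, ∑ k, |Δ j k| * (5 * q) := by
          refine (Finset.abs_sum_le_sum_abs _ _).trans (Finset.sum_le_sum fun j _ => ?_)
          refine (Finset.abs_sum_le_sum_abs _ _).trans (Finset.sum_le_sum fun k _ => ?_)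
          rw [abs_mul]
          exact mul_le_mul_of_nonneg_left (hscore j k) (abs_nonneg _)
      _ = (∑ j, ∑ k, |Δ j k|) * (5 * q) := by simp only [← Finset.sum_mul]
      _ ≤ (2 * (C + A)) * (5 * q) := by
          rw [← hy]
          exact mul_le_mul_of_nonneg_right (sum_sum_abs_le hΔ) (by positivity)
      _ = 10 * q * (C + A) := by ring
  obtain ⟨hlin1, hlin2⟩ := abs_le.1 hlin'
  have hT' : (0 : ℝ) < T := by exact_mod_cast hT
  have hopt : D - lin + 32 * q * (normOne (θ + Δ) - normOne θ) ≤ 0 := by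
    have := mul_le_mul_of_nonneg_left (hmin.2 θ hθ) hT'.le
    simp only [loss] at this
    rw [← hdiff]
    have e1 : ∀ a b : ℝ, T * (1 / T * a + 32 * c * √(n * L) / T * b) = a + 32 * q * b := by
      intro a b
      rw [hq]
      field_simp
    rw [e1, e1] at this
    linarith
  have hnorm := normOne_add_ge θ Δ
  have hnorm' : 32 * q * (C - A) ≤ 32 * q * (normOne (θ + Δ) - normOne θ) :=
    mul_le_mul_of_nonneg_left (by linarith) (by positivity)
  -- The score term costs at most `10 q (C + A)` while the penalty returns `32 q (C - A)`; the
  -- difference leaves the coefficients `22` and `42`.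
  have hDC : D + 22 * (q * C) ≤ 42 * (q * A) := by linarith
  have hCA : C ≤ 3 * A := by
    have : q * (22 * C) ≤ q * (42 * A) := by linarith
    have := le_of_mul_le_mul_left this hq0
    linarith
  have hDA : D ≤ 42 * q * A := by linarith [mul_nonneg hq0.le hC0]
  have hmain : q * A ≤ 336 * (c ^ 2 * (s / ρ)) * L := by
    rcases hA0.eq_or_lt with h0 | hA1
    · rw [← h0, mul_zero]; positivity
    have hAs : A ^ 2 ≤ s * normTwoSq Δ := sq_sum_supp_le θ Δ
    have hs : 0 < s := by
      refine hs0.lt_of_ne fun h => ?_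
      rw [← h, zero_mul] at hAs
      linarith [pow_pos hA1 2]
    have hcone : Δ ∈ cone θ := ⟨hΔ, hCA⟩
    have hQ := hquad (Nat.cast_pos.1 hs) Δ hcone
    -- The factor `t / 4` of the curvature bound and the half of the segment in `J` turn `42` into
    -- `8 * 42 = 336`.
    have hDlow : ∀ t : ℝ, 0 < t → t ≤ 1 → t * (c * (C + A)) ≤ 1 →
        t * (ρ * n * A) ≤ 336 * q * s := by
      intro t ht ht1 htR
      have h1 : t / 4 * ∑ i ∈ J, quadForm B₀ B θ Δ (x i) ≤ D := by
        rw [Finset.mul_sum]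
        refine le_trans (Finset.sum_le_sum fun i _ =>
          condVar_le_excess hB θ Δ (x i) ht ht1 fun j => le_trans ?_ htR)
          (Finset.sum_le_sum_of_subset_of_nonneg hJI fun _ _ _ => excess_nonneg _ _ _)
        rw [← hy]
        exact mul_le_mul_of_nonneg_left
          (mul_le_mul_of_nonneg_left (sum_row_le_normOne hΔ j) hc.le) ht.le
      have h2 : ρ * (n / 2) * (A ^ 2 / s) ≤ ρ * J.card * normTwoSq Δ := by
        have : A ^ 2 / s ≤ normTwoSq Δ := by rw [div_le_iff₀ hs]; linarith
        have hJ' : n / 2 ≤ (J.card : ℝ) := by linarith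
        gcongr
      have h3 : t / 4 * (ρ * (n / 2) * (A ^ 2 / s)) ≤ 42 * q * A :=
        (mul_le_mul_of_nonneg_left (h2.trans hQ) (by positivity)).trans (h1.trans hDA)
      have h4 : t * (ρ * n * A) * A ≤ 336 * q * s * A := by
        have e : t / 4 * (ρ * (n / 2) * (A ^ 2 / s)) * (8 * s) = t * (ρ * n * A) * A := by
          field_simp; ring
        rw [← e]
        have := mul_le_mul_of_nonneg_right h3 (by positivity : 0 ≤ 8 * s)
        linarith
      exact le_of_mul_le_mul_right h4 hA1
    exact mul_le_of_localized_curvature hc hρ hL hs hn0 hq0 hA1 hC0 hCA hq2 hn hDlow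
  -- Optimality gives `D - lin ≤ 32 q A`, and `D ≥ 0` gives `D - lin ≥ -10 q (C + A) ≥ -40 q A`; the
  -- constant is `40 * 336 = 13440`.
  rw [hdiff, abs_le]
  have hqC : q * C ≤ q * (3 * A) := mul_le_mul_of_nonneg_left hCA hq0.le
  have hqA : 0 ≤ q * A := mul_nonneg hq0.le hA0
  have hqC0 : 0 ≤ q * C := mul_nonneg hq0.le hC0
  constructor
  · linarith
  · linarith

end Oracle

/-! ### Concentration of scores, conditional covariances and signal -/

section Probability

variable {p : ℕ} {𝒳 : Type*} [Fintype 𝒳] [MeasurableSpace 𝒳]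
  {Ω : Type*} [MeasurableSpace Ω] {μ : Measure Ω} {B₀ : 𝒳 → ℝ}
  {B : 𝒳 → 𝒳 → ℝ} {θ₁ θ₂ : Matrix (Fin p) (Fin p) ℝ} {T τs : ℕ} {X : ℕ → Ω → Fin p → 𝒳}

/-- The parameter of the law of the observation at time `t`. -/
def paramAt (θ₁ θ₂ : Matrix (Fin p) (Fin p) ℝ) (τs t : ℕ) : Matrix (Fin p) (Fin p) ℝ :=
  if t ≤ τs then θ₁ else θ₂

lemma paramAt_of_le {t : ℕ} (h : t ≤ τs) : paramAt θ₁ θ₂ τs t = θ₁ := if_pos h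

lemma paramAt_of_lt {t : ℕ} (h : τs < t) : paramAt θ₁ θ₂ τs t = θ₂ := if_neg h.not_ge

variable [MeasurableSingletonClass 𝒳] [IsProbabilityMeasure μ]

lemma integral_comp_eq_expect (hM : IsSingleChangePointModel μ B₀ B θ₁ θ₂ T τs X) {t : ℕ}
    (ht : t ∈ Finset.Icc 1 T) (F : (Fin p → 𝒳) → ℝ) :
    ∫ ω, F (X t ω) ∂μ = expect B₀ B (paramAt θ₁ θ₂ τs t) F := by
  have hX := hM.measurable t ht
  have hF : Measurable F := measurable_of_finite F
  have : IsProbabilityMeasure (μ.map (X t)) := Measure.isProbabilityMeasure_map hX.aemeasurable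
  rw [← integral_map hX.aemeasurable hF.aestronglyMeasurable, integral_fintype .of_finite, expect]
  refine Finset.sum_congr rfl fun x _ => ?_
  rw [smul_eq_mul, map_measureReal_apply hX (measurableSet_singleton x)]
  congr 1
  obtain ⟨h1, h2⟩ := Finset.mem_Icc.1 ht
  rcases le_or_gt t τs with h | h
  · rw [paramAt_of_le h, hM.before t (Finset.mem_Icc.2 ⟨h1, h⟩)]
  · rw [paramAt_of_lt h, hM.after t (Finset.mem_Icc.2 ⟨h, h2⟩)]

/-- Hoeffding's inequality for a bounded function of the observations. -/
lemma measure_sum_sub_expect_ge_le (hM : IsSingleChangePointModel μ B₀ B θ₁ θ₂ T τs X)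
    {J : Finset ℕ} (hJ : J ⊆ Finset.Icc 1 T) {F : (Fin p → 𝒳) → ℝ} {c ε : ℝ}
    (hF : ∀ x, |F x| ≤ c) (hc : 0 ≤ c) (hε : 0 ≤ ε) :
    μ.real {ω | ε ≤ ∑ t ∈ J, (F (X t ω) - expect B₀ B (paramAt θ₁ θ₂ τs t) F)}
      ≤ Real.exp (-(ε ^ 2 / (2 * J.card * c ^ 2))) := by
  have hFm : Measurable F := measurable_of_finite F
  let Y : Finset.Icc 1 T → Ω → ℝ := fun t ω =>
    F (X t ω) - expect B₀ B (paramAt θ₁ θ₂ τs t) F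
  have hind : iIndepFun Y μ :=
    hM.indep.comp (fun t x => F x - expect B₀ B (paramAt θ₁ θ₂ τs t) F)
      fun t => hFm.sub_const _
  have hsub : ∀ t ∈ J.subtype (· ∈ Finset.Icc 1 T),
      HasSubgaussianMGF (Y t) ((‖c - -c‖₊ / 2) ^ 2) μ := fun t _ => by
    have := hasSubgaussianMGF_of_mem_Icc (μ := μ) (X := fun ω => F (X t ω)) (a := -c) (b := c)
      (hFm.comp (hM.measurable t t.2)).aemeasurable
      (Filter.Eventually.of_forall fun ω => abs_le.1 (hF _))
    rwa [integral_comp_eq_expect hM t.2] at this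
  have h := HasSubgaussianMGF.measure_sum_ge_le_of_iIndepFun hind hsub hε
  have hcard : (J.subtype (· ∈ Finset.Icc 1 T)).card = J.card := by
    rw [Finset.card_subtype, Finset.filter_true_of_mem hJ]
  have hsum : ∀ ω, ∑ t ∈ J.subtype (· ∈ Finset.Icc 1 T), Y t ω
      = ∑ t ∈ J, (F (X t ω) - expect B₀ B (paramAt θ₁ θ₂ τs t) F) := fun ω =>
    Finset.sum_subtype_of_mem (f := fun t => F (X t ω) - expect B₀ B (paramAt θ₁ θ₂ τs t) F)
      fun t ht => hJ ht
  simp only [hsum] at h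
  refine h.trans (le_of_eq ?_)
  congr 1
  rw [Finset.sum_const, hcard, nsmul_eq_mul]
  push_cast
  have hnorm : ‖c - -c‖ / 2 = c := by
    rw [Real.norm_of_nonneg (by linarith)]; ring
  rw [hnorm, neg_div, mul_assoc]

lemma measure_abs_sum_sub_expect_gt_le (hM : IsSingleChangePointModel μ B₀ B θ₁ θ₂ T τs X)
    {J : Finset ℕ} (hJ : J ⊆ Finset.Icc 1 T) {F : (Fin p → 𝒳) → ℝ} {c ε : ℝ}
    (hF : ∀ x, |F x| ≤ c) (hc : 0 ≤ c) (hε : 0 ≤ ε) :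
    μ.real {ω | ε < |∑ t ∈ J, (F (X t ω) - expect B₀ B (paramAt θ₁ θ₂ τs t) F)|}
      ≤ 2 * Real.exp (-(ε ^ 2 / (2 * J.card * c ^ 2))) := by
  have h1 := measure_sum_sub_expect_ge_le hM hJ hF hc hε
  have h2 := measure_sum_sub_expect_ge_le hM hJ (F := fun x => (-1) * F x) (c := c)
    (fun x => by rw [neg_one_mul, abs_neg]; exact hF x) hc hε
  have hsum : ∀ ω, ∑ t ∈ J, ((-1) * F (X t ω)
      - expect B₀ B (paramAt θ₁ θ₂ τs t) fun x => (-1) * F x)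
      = -∑ t ∈ J, (F (X t ω) - expect B₀ B (paramAt θ₁ θ₂ τs t) F) := fun ω => by
    simp only [expect_mul_left, ← Finset.sum_neg_distrib]
    exact Finset.sum_congr rfl fun _ _ => by ring
  simp only [hsum] at h2
  refine (measureReal_mono (fun ω hω => ?_)).trans ((measureReal_union_le
    {ω | ε ≤ ∑ t ∈ J, (F (X t ω) - expect B₀ B (paramAt θ₁ θ₂ τs t) F)}
    {ω | ε ≤ -∑ t ∈ J, (F (X t ω) - expect B₀ B (paramAt θ₁ θ₂ τs t) F)}).trans (by linarith))
  rcases lt_abs.1 (Set.mem_ofPred_eq ▸ hω) with h | h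
  · exact Or.inl h.le
  · exact Or.inr h.le

/-- Three noise levels yield the Hoeffding exponent `9 L / 2`; keeping `4 L` is enough for a union
over `T p³` events. -/
lemma measure_score_le (hM : IsSingleChangePointModel μ B₀ B θ₁ θ₂ T τs X)
    (hB : ∀ u v, B u v = B v u) (hc : 0 < fluct B₀ B) {L : ℝ} (hL : 0 < L) {I : Finset ℕ}
    (hI : I ⊆ Finset.Icc 1 T) (θ : Matrix (Fin p) (Fin p) ℝ) (j k : Fin p) :
    μ.real {ω | 3 * (fluct B₀ B * √(I.card * L)) < |∑ t ∈ I, (score B₀ B θ j k (X t ω)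
      - expect B₀ B (paramAt θ₁ θ₂ τs t) (score B₀ B θ j k))|} ≤ 2 * Real.exp (-(4 * L)) := by
  rcases I.eq_empty_or_nonempty with rfl | hne
  · simp [Real.exp_nonneg]
  have hn : (0 : ℝ) < I.card := Nat.cast_pos.2 hne.card_pos
  refine (measure_abs_sum_sub_expect_gt_le hM hI (abs_score_le hB θ j k) hc.le
    (by positivity)).trans ?_
  have : (3 * (fluct B₀ B * √(I.card * L))) ^ 2 / (2 * I.card * fluct B₀ B ^ 2) = 9 / 2 * L := by
    rw [mul_pow, mul_pow, Real.sq_sqrt (by positivity)]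
    field_simp
    norm_num
  rw [this]
  gcongr
  norm_num

/-- The accuracy is the one that `le_sum_quadForm` tolerates. With `r = c₀² s / ρ` the Hoeffding
exponent is `|J| / (8192 r²)`, and the size condition makes it at least `288 L`. For `s = 0` the
event is empty. -/
lemma measure_condCov_le (hM : IsSingleChangePointModel μ B₀ B θ₁ θ₂ T τs X)
    (hB : ∀ u v, B u v = B v u) (hc : 0 < fluct B₀ B) {L ρ : ℝ} (hL : 0 < L) (hρ : 0 < ρ)
    {J : Finset ℕ} (hJ : J ⊆ Finset.Icc 1 T) (θ : Matrix (Fin p) (Fin p) ℝ)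
    (hn : 1536 ^ 2 * (fluct B₀ B ^ 2 * (sparsity θ / ρ)) ^ 2 * L ≤ J.card)
    (i k l : Fin p) :
    μ.real {ω | ρ * J.card / 64 < sparsity θ * |∑ t ∈ J, (condCov B₀ B θ i k l (X t ω)
      - expect B₀ B (paramAt θ₁ θ₂ τs t) (condCov B₀ B θ i k l))|}
      ≤ 2 * Real.exp (-(4 * L)) := by
  rcases (Nat.cast_nonneg (α := ℝ) (sparsity θ)).eq_or_lt with h0 | hs
  · have : {ω | ρ * J.card / 64 < sparsity θ * |∑ t ∈ J, (condCov B₀ B θ i k l (X t ω)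
      - expect B₀ B (paramAt θ₁ θ₂ τs t) (condCov B₀ B θ i k l))|} = ∅ := by
      ext ω
      simp only [← h0, zero_mul, Set.mem_ofPred_eq, Set.mem_empty_iff_false, iff_false, not_lt]
      positivity
    rw [this]
    simp [Real.exp_nonneg]
  set s : ℝ := (sparsity θ : ℝ) with hsdef
  set c := fluct B₀ B with hcdef
  have hn0 : (0 : ℝ) < J.card := lt_of_lt_of_le (by positivity) hn
  have hset : {ω | ρ * J.card / 64 < s * |∑ t ∈ J, (condCov B₀ B θ i k l (X t ω)
      - expect B₀ B (paramAt θ₁ θ₂ τs t) (condCov B₀ B θ i k l))|}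
      = {ω | ρ * J.card / 64 / s < |∑ t ∈ J, (condCov B₀ B θ i k l (X t ω)
      - expect B₀ B (paramAt θ₁ θ₂ τs t) (condCov B₀ B θ i k l))|} := by
    ext ω
    simp only [Set.mem_ofPred_eq, div_lt_iff₀ hs, mul_comm s]
  rw [hset]
  refine (measure_abs_sum_sub_expect_gt_le hM hJ (abs_condCov_le hB θ i k l) (sq_nonneg _)
    (by positivity)).trans ?_
  gcongr
  rw [← hcdef]
  have e : (ρ * J.card / 64 / s) ^ 2 / (2 * J.card * (c ^ 2) ^ 2)
      = J.card / (8192 * (c ^ 2 * (s / ρ)) ^ 2) := by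
    field_simp; norm_num
  rw [e, le_div_iff₀ (by positivity)]
  have : 0 ≤ (c ^ 2 * (s / ρ)) ^ 2 * L := by positivity
  linarith

lemma measure_sum_phi_sub_le (hM : IsSingleChangePointModel μ B₀ B θ₁ θ₂ T τs X)
    {J : Finset ℕ} (hJ : J ⊆ Finset.Icc 1 T) {θ θ' : Matrix (Fin p) (Fin p) ℝ} {κ v : ℝ}
    (hlaw : ∀ t ∈ J, paramAt θ₁ θ₂ τs t = θ) (hv : 0 ≤ v)
    (hφ : ∀ x, |phi B₀ B θ' x - phi B₀ B θ x| ≤ v) (hκ0 : 0 ≤ κ)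
    (hκ : κ ≤ expect B₀ B θ fun x => phi B₀ B θ' x - phi B₀ B θ x) :
    μ.real {ω | ∑ t ∈ J, (phi B₀ B θ' (X t ω) - phi B₀ B θ (X t ω)) ≤ κ * J.card / 2}
      ≤ Real.exp (-(κ ^ 2 * J.card / (8 * v ^ 2))) := by
  have h := measure_sum_sub_expect_ge_le hM hJ (F := fun x => phi B₀ B θ x - phi B₀ B θ' x)
    (c := v) (ε := κ * J.card / 2) (fun x => by rw [abs_sub_comm]; exact hφ x) hv (by positivity)
  -- If `J` is empty or `v = 0`, both quotients are zero by convention.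
  have e : (κ * J.card / 2) ^ 2 / (2 * J.card * v ^ 2) = κ ^ 2 * J.card / (8 * v ^ 2) := by
    rcases J.eq_empty_or_nonempty with rfl | hne
    · simp
    have hn : (0 : ℝ) < J.card := Nat.cast_pos.2 hne.card_pos
    by_cases hv0 : v = 0
    · simp [hv0]
    field_simp
    norm_num
  rw [e] at h
  refine (measureReal_mono fun ω hω => ?_).trans h
  simp only [Set.mem_ofPred_eq] at hω ⊢
  have hE : ∀ t ∈ J, (phi B₀ B θ (X t ω) - phi B₀ B θ' (X t ω)
      - expect B₀ B (paramAt θ₁ θ₂ τs t) fun x => phi B₀ B θ x - phi B₀ B θ' x)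
      ≥ κ - (phi B₀ B θ' (X t ω) - phi B₀ B θ (X t ω)) := fun t ht => by
    rw [hlaw t ht, expect_sub]
    rw [expect_sub] at hκ
    linarith
  have := Finset.sum_le_sum hE
  rw [Finset.sum_sub_distrib, Finset.sum_const, nsmul_eq_mul] at this
  linarith

end Probability

/-! ### Union bounds and geometric sums -/

section Bounds

lemma sum_pow_le_of_injOn {A : Finset ℕ} {f : ℕ → ℕ} (hf : Set.InjOn f A) {r : ℝ} (h0 : 0 ≤ r)
    (h1 : r < 1) : ∑ t ∈ A, r ^ f t ≤ 1 / (1 - r) := by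
  classical
  rw [← Finset.sum_image (f := fun n => r ^ n) hf, one_div, ← tsum_geometric_of_lt_one h0 h1]
  exact (summable_geometric_of_lt_one h0 h1).sum_le_tsum _ fun _ _ => pow_nonneg h0 _

/-- A union bound with geometrically decaying probabilities. -/
lemma sum_exp_neg_le {A : Finset ℕ} {f : ℕ → ℕ} (hf : Set.InjOn f A) {q x : ℝ} (hq : 0 < q)
    (hx : 2 ≤ x) (hA : ∀ t ∈ A, x - 1 < f t) :
    ∑ t ∈ A, Real.exp (-(4 * q * f t)) ≤ Real.exp (-(q * x)) / (1 - Real.exp (-q)) := by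
  -- As `3 f > 3 (x - 1) ≥ x`, three of the four copies of `q f` pay for `exp (-(q x))` and the
  -- fourth is left for the geometric series.
  have h : ∀ t ∈ A, Real.exp (-(4 * q * f t)) ≤ Real.exp (-(q * x)) * Real.exp (-q) ^ f t :=
    fun t ht => by
      rw [← Real.exp_nat_mul, ← Real.exp_add, Real.exp_le_exp]
      have := hA t ht
      nlinarith
  refine (Finset.sum_le_sum h).trans ?_
  rw [← Finset.mul_sum, div_eq_mul_one_div]
  exact mul_le_mul_of_nonneg_left
    (sum_pow_le_of_injOn hf (Real.exp_pos _).le (Real.exp_lt_one_iff.2 (by linarith)))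
    (Real.exp_pos _).le

lemma measure_biUnion_le_card_mul {Ω ι : Type*} [MeasurableSpace Ω] {μ : Measure Ω}
    (s : Finset ι) {A : ι → Set Ω} {ε : ℝ} (h : ∀ i ∈ s, μ.real (A i) ≤ ε) :
    μ.real (⋃ i ∈ s, A i) ≤ s.card * ε := by
  refine (measureReal_biUnion_finset_le s A).trans ((Finset.sum_le_sum h).trans ?_)
  rw [Finset.sum_const, nsmul_eq_mul]

lemma one_le_dimn {p : ℕ} (hp : 0 < p) : 1 ≤ dimn p := by
  have : (1 : ℝ) ≤ p := by exact_mod_cast hp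
  unfold dimn
  nlinarith

lemma sq_le_two_mul_dimn (p : ℕ) : (p : ℝ) ^ 2 ≤ 2 * dimn p := by
  have : (0 : ℝ) ≤ p := Nat.cast_nonneg p
  unfold dimn
  nlinarith

lemma le_dimn (p : ℕ) : (p : ℝ) ≤ dimn p := by
  rcases Nat.eq_zero_or_pos p with rfl | hp
  · simp [dimn]
  have : (1 : ℝ) ≤ p := by exact_mod_cast hp
  unfold dimn
  nlinarith

lemma exp_neg_four_mul_log {y : ℝ} (hy : 0 < y) :
    Real.exp (-(4 * Real.log y)) = 1 / y ^ 4 := by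
  rw [Real.exp_neg, one_div, show (4 : ℝ) * Real.log y = Real.log y * (4 : ℕ) by push_cast; ring,
    mul_comm, Real.exp_nat_mul, Real.exp_log hy]

/-- Each event has probability at most `2 (dT)⁻⁴`, and `p³ ≤ 2 d²` because `p² ≤ 2 d` and `p ≤ d`.
-/
lemma card_mul_exp_le {p T : ℕ} (hp : 0 < p) (hT : 0 < T) {n : ℕ} (hn : n ≤ T * p ^ 3) :
    (n : ℝ) * (2 * Real.exp (-(4 * Real.log (dimn p * T)))) ≤ 4 / dimn p := by
  have hd := one_le_dimn hp
  have hd0 : 0 < dimn p := by linarith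
  have hT' : (1 : ℝ) ≤ T := by exact_mod_cast hT
  have hn' : (n : ℝ) ≤ T * (2 * dimn p * dimn p) := by
    have h1 : (n : ℝ) ≤ T * (p : ℝ) ^ 3 := by exact_mod_cast hn
    refine h1.trans (mul_le_mul_of_nonneg_left ?_ (by linarith))
    have : (p : ℝ) ^ 3 = p ^ 2 * p := by ring
    rw [this]
    exact mul_le_mul (sq_le_two_mul_dimn p) (le_dimn p) (Nat.cast_nonneg p) (by linarith)
  rw [exp_neg_four_mul_log (by positivity)]
  calc (n : ℝ) * (2 * (1 / (dimn p * T) ^ 4))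
      ≤ T * (2 * dimn p * dimn p) * (2 * (1 / (dimn p * T) ^ 4)) := by gcongr
    _ = 4 / (dimn p ^ 2 * T ^ 3) := by field_simp; norm_num
    _ ≤ 4 / dimn p := by
        gcongr
        have : 1 ≤ dimn p * (T : ℝ) ^ 3 := by
          nlinarith [one_le_pow₀ hT' (n := 3)]
        nlinarith

end Bounds

/-! ### Contaminated segments and accuracy of the estimate on typical data -/

section Segments

variable {p : ℕ} {𝒳 : Type*} {B₀ : 𝒳 → ℝ} {B : 𝒳 → 𝒳 → ℝ} {θ₁ θ₂ : Matrix (Fin p) (Fin p) ℝ}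
  {ρ₁ ρ₂ κ m : ℝ} {T τs τ : ℕ} {S : Finset ℕ} {x : ℕ → Fin p → 𝒳}
  {θhat : Matrix (Fin p) (Fin p) ℝ}

lemma card_Icc_one (τ : ℕ) : ((Finset.Icc 1 τ).card : ℝ) = τ := by simp

lemma card_Icc_add_one {τ τ' : ℕ} (h : τ ≤ τ') :
    ((Finset.Icc (τ + 1) τ').card : ℝ) = (τ' : ℝ) - τ := by
  rw [Nat.card_Icc, Nat.add_sub_add_right, Nat.cast_sub h]

lemma size_left (hS : IsSearchDomain (fluct B₀ B) p T τs θ₁ θ₂ ρ₁ ρ₂ S) (hτ : τ ∈ S) :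
    1536 ^ 2 * (fluct B₀ B ^ 2 * (sparsity θ₁ / ρ₁)) ^ 2 * Real.log (dimn p * T)
      ≤ (Finset.Icc 1 τ).card := by
  have h := (hS.size τ hτ).1
  rw [max_eq_right (by norm_num)] at h
  rw [card_Icc_one]
  refine le_trans (le_of_eq ?_) h
  ring

lemma size_right (hS : IsSearchDomain (fluct B₀ B) p T τs θ₁ θ₂ ρ₁ ρ₂ S) (hτ : τ ∈ S) :
    1536 ^ 2 * (fluct B₀ B ^ 2 * (sparsity θ₂ / ρ₂)) ^ 2 * Real.log (dimn p * T)
      ≤ (Finset.Icc (τ + 1) T).card := by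
  have h := (hS.size τ hτ).2
  rw [max_eq_right (by norm_num)] at h
  rw [card_Icc_add_one (Finset.mem_Icc.1 (hS.subset hτ)).2]
  refine le_trans (le_of_eq ?_) h
  ring

variable [Fintype 𝒳]

/-- The oracle inequality for a segment `I` with observations of law `g_θ` on `J` and of law
`g_θ'` on `I \ J`. -/
lemma abs_sum_phi_sub_le_of_contaminated [Nonempty 𝒳] {θ θ' θhat : Matrix (Fin p) (Fin p) ℝ}
    {ϑ : ℕ → Matrix (Fin p) (Fin p) ℝ} {ρ L b : ℝ} {I J : Finset ℕ} {x : ℕ → Fin p → 𝒳} {T : ℕ}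
    (hB : ∀ u v, B u v = B v u) (hT : 0 < T) (hL : 0 < L) (hc : 0 < fluct B₀ B)
    (hρ : RestrictedStrongConvexity B₀ B θ ρ) (hθ : θ.IsSymm) (hθ' : θ'.IsSymm)
    (hJI : J ⊆ I) (hJ : (I.card : ℝ) ≤ 2 * J.card)
    (hϑ : ∀ t ∈ J, ϑ t = θ) (hϑ' : ∀ t ∈ I \ J, ϑ t = θ')
    (hrow : ∀ j, ∑ k, |(θ' - θ) j k| ≤ b)
    (hb : fluct B₀ B * b * (I \ J).card ≤ 2 * √(I.card * L))
    (hn : 1536 ^ 2 * (fluct B₀ B ^ 2 * (sparsity θ / ρ)) ^ 2 * L ≤ J.card)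
    (hscore : ∀ j k, |∑ t ∈ I, (score B₀ B θ j k (x t)
      - expect B₀ B (ϑ t) (score B₀ B θ j k))| ≤ 3 * (fluct B₀ B * √(I.card * L)))
    (hcov : ∀ i k l, sparsity θ * |∑ t ∈ J, (condCov B₀ B θ i k l (x t)
      - expect B₀ B (ϑ t) (condCov B₀ B θ i k l))| ≤ ρ * J.card / 64)
    (hmin : IsPenalizedMinimizer B₀ B T I x (32 * fluct B₀ B * √(I.card * L) / T) θhat) :
    |∑ t ∈ I, phi B₀ B θhat (x t) - ∑ t ∈ I, phi B₀ B θ (x t)|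
      ≤ 13440 * (fluct B₀ B ^ 2 * (sparsity θ / ρ)) * L := by
  have hJI' : (J.card : ℝ) ≤ I.card := by exact_mod_cast Finset.card_le_card hJI
  refine abs_sum_phi_sub_le hB hT hL hc hρ.1 hθ hJI hJ (hn.trans hJI') (fun j k => ?_)
    (fun hs Δ hΔ => le_sum_quadForm hρ hs (fun i k l => ?_) hΔ) hmin
  -- Only contaminating observations have a non-zero mean score. The gap condition keeps the total
  -- bias within two noise levels, which with the three of the fluctuation make the five that the
  -- oracle inequality allows.
  · have hbias : |∑ t ∈ I, expect B₀ B (ϑ t) (score B₀ B θ j k)|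
        ≤ 2 * (fluct B₀ B * √(I.card * L)) := by
      rw [← Finset.sum_sdiff hJI, Finset.sum_eq_zero (s := J) fun t ht => by
        rw [hϑ t ht, expect_score hB hθ], add_zero]
      calc |∑ t ∈ I \ J, expect B₀ B (ϑ t) (score B₀ B θ j k)|
          ≤ ∑ t ∈ I \ J, fluct B₀ B * (fluct B₀ B * b) := by
            refine (Finset.abs_sum_le_sum_abs _ _).trans (Finset.sum_le_sum fun t ht => ?_)
            rw [hϑ' t ht]
            exact (abs_expect_score_le hB hθ' θ j k).trans (mul_le_mul_of_nonneg_left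
              (mul_le_mul_of_nonneg_left (hrow j) hc.le) hc.le)
        _ = fluct B₀ B * (fluct B₀ B * b * (I \ J).card) := by
            rw [Finset.sum_const, nsmul_eq_mul]; ring
        _ ≤ fluct B₀ B * (2 * √(I.card * L)) := mul_le_mul_of_nonneg_left hb hc.le
        _ = 2 * (fluct B₀ B * √(I.card * L)) := by ring
    have h := hscore j k
    rw [Finset.sum_sub_distrib] at h
    have h2 := abs_sub_abs_le_abs_sub (∑ t ∈ I, score B₀ B θ j k (x t))
      (∑ t ∈ I, expect B₀ B (ϑ t) (score B₀ B θ j k))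
    linarith
  · have e : ∑ t ∈ J, (condCov B₀ B θ i k l (x t) - expect B₀ B (ϑ t) (condCov B₀ B θ i k l))
        = ∑ t ∈ J, (condCov B₀ B θ i k l (x t) - expect B₀ B θ (condCov B₀ B θ i k l)) :=
      Finset.sum_congr rfl fun t ht => by rw [hϑ t ht]
    rw [← e]
    exact hcov i k l

/-- The data are typical for the search domain `S`: the scores and the conditional covariances
concentrate uniformly, and the change in law is visible at all lags larger than `m`. -/
structure IsTypical (B₀ : 𝒳 → ℝ) (B : 𝒳 → 𝒳 → ℝ) (θ₁ θ₂ : Matrix (Fin p) (Fin p) ℝ)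
    (T τs : ℕ) (ρ₁ ρ₂ L κ m : ℝ) (S : Finset ℕ) (x : ℕ → Fin p → 𝒳) : Prop where
  score_left : ∀ τ ∈ S, ∀ j k, |∑ t ∈ Finset.Icc 1 τ, (score B₀ B θ₁ j k (x t)
    - expect B₀ B (paramAt θ₁ θ₂ τs t) (score B₀ B θ₁ j k))|
      ≤ 3 * (fluct B₀ B * √((Finset.Icc 1 τ).card * L))
  score_right : ∀ τ ∈ S, ∀ j k, |∑ t ∈ Finset.Icc (τ + 1) T, (score B₀ B θ₂ j k (x t)
    - expect B₀ B (paramAt θ₁ θ₂ τs t) (score B₀ B θ₂ j k))|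
      ≤ 3 * (fluct B₀ B * √((Finset.Icc (τ + 1) T).card * L))
  cov_left : ∀ τ ∈ S, τ ≤ τs → ∀ i k l, sparsity θ₁ * |∑ t ∈ Finset.Icc 1 τ,
    (condCov B₀ B θ₁ i k l (x t) - expect B₀ B (paramAt θ₁ θ₂ τs t) (condCov B₀ B θ₁ i k l))|
      ≤ ρ₁ * (Finset.Icc 1 τ).card / 64
  cov_right : ∀ τ ∈ S, τs ≤ τ → ∀ i k l, sparsity θ₂ * |∑ t ∈ Finset.Icc (τ + 1) T,
    (condCov B₀ B θ₂ i k l (x t) - expect B₀ B (paramAt θ₁ θ₂ τs t) (condCov B₀ B θ₂ i k l))|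
      ≤ ρ₂ * (Finset.Icc (τ + 1) T).card / 64
  signal_right : ∀ τ ∈ S, τs < τ → m < ((τ - τs : ℕ) : ℝ) →
    κ * (Finset.Icc (τs + 1) τ).card / 2
      < ∑ t ∈ Finset.Icc (τs + 1) τ, (phi B₀ B θ₁ (x t) - phi B₀ B θ₂ (x t))
  signal_left : ∀ τ ∈ S, τ < τs → m < ((τs - τ : ℕ) : ℝ) →
    κ * (Finset.Icc (τ + 1) τs).card / 2
      < ∑ t ∈ Finset.Icc (τ + 1) τs, (phi B₀ B θ₂ (x t) - phi B₀ B θ₁ (x t))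

/-- The observations of law `g_{θ₁}` end at `min τ τs`, again a point of `S`, so the covariance and
size conditions are available there; `τ ≤ 2 τs` makes them at least half of the segment. -/
lemma left_segment_oracle [Nonempty 𝒳] (hB : ∀ u v, B u v = B v u) (hT : 0 < T)
    (hL : 0 < Real.log (dimn p * T)) (hc : 0 < fluct B₀ B) (h₁ : θ₁.IsSymm) (h₂ : θ₂.IsSymm)
    (hρ₁ : RestrictedStrongConvexity B₀ B θ₁ ρ₁)
    (hS : IsSearchDomain (fluct B₀ B) p T τs θ₁ θ₂ ρ₁ ρ₂ S)
    (hx : IsTypical B₀ B θ₁ θ₂ T τs ρ₁ ρ₂ (Real.log (dimn p * T)) κ m S x)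
    (hτ : τ ∈ S) (hhalf : τ ≤ 2 * τs)
    (hmin : IsPenalizedMinimizer B₀ B T (Finset.Icc 1 τ) x
      (penalty (fluct B₀ B) p T τ) θhat) :
    |∑ t ∈ Finset.Icc 1 τ, phi B₀ B θhat (x t) - ∑ t ∈ Finset.Icc 1 τ, phi B₀ B θ₁ (x t)|
      ≤ 13440 * (fluct B₀ B ^ 2 * (sparsity θ₁ / ρ₁)) * Real.log (dimn p * T) := by
  rw [penalty, ← card_Icc_one τ] at hmin
  have hmem : min τ τs ∈ S := by
    rcases min_choice τ τs with h | h <;> rw [h]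
    exacts [hτ, hS.mem]
  have hsub : Finset.Icc 1 (min τ τs) ⊆ Finset.Icc 1 τ :=
    Finset.Icc_subset_Icc_right (min_le_left _ _)
  refine abs_sum_phi_sub_le_of_contaminated (θ' := θ₂) (ϑ := paramAt θ₁ θ₂ τs)
    (J := Finset.Icc 1 (min τ τs)) (b := rowGap θ₁ θ₂) hB hT hL hc hρ₁ h₁ h₂ hsub ?_
    (fun t ht => paramAt_of_le ?_) (fun t ht => paramAt_of_lt ?_) (sum_row_le_rowGap θ₁ θ₂) ?_
    (size_left hS hmem) (hx.score_left τ hτ) (hx.cov_left _ hmem (min_le_right _ _)) hmin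
  · rw [card_Icc_one, card_Icc_one]
    have : τ ≤ 2 * min τ τs := by omega
    exact_mod_cast this
  · exact (Finset.mem_Icc.1 ht).2.trans (min_le_right _ _)
  · simp only [Finset.mem_sdiff, Finset.mem_Icc] at ht
    omega
  · rw [Finset.card_sdiff_of_subset hsub, Nat.cast_sub (Finset.card_le_card hsub), card_Icc_one,
      card_Icc_one]
    rcases le_or_gt τ τs with h | h
    · rw [min_eq_left h, sub_self, mul_zero]
      positivity
    · rw [min_eq_right h.le]
      exact (hS.right τ hτ h).1

lemma right_segment_oracle [Nonempty 𝒳] (hB : ∀ u v, B u v = B v u) (hT : 0 < T)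
    (hL : 0 < Real.log (dimn p * T)) (hc : 0 < fluct B₀ B) (h₁ : θ₁.IsSymm) (h₂ : θ₂.IsSymm)
    (hρ₂ : RestrictedStrongConvexity B₀ B θ₂ ρ₂)
    (hS : IsSearchDomain (fluct B₀ B) p T τs θ₁ θ₂ ρ₁ ρ₂ S)
    (hx : IsTypical B₀ B θ₁ θ₂ T τs ρ₁ ρ₂ (Real.log (dimn p * T)) κ m S x)
    (hτ : τ ∈ S) (hhalf : T - τ ≤ 2 * (T - τs))
    (hmin : IsPenalizedMinimizer B₀ B T (Finset.Icc (τ + 1) T) x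
      (penalty (fluct B₀ B) p T ((T : ℝ) - τ)) θhat) :
    |∑ t ∈ Finset.Icc (τ + 1) T, phi B₀ B θhat (x t)
        - ∑ t ∈ Finset.Icc (τ + 1) T, phi B₀ B θ₂ (x t)|
      ≤ 13440 * (fluct B₀ B ^ 2 * (sparsity θ₂ / ρ₂)) * Real.log (dimn p * T) := by
  have hτT := (Finset.mem_Icc.1 (hS.subset hτ)).2
  have hτsT := (Finset.mem_Icc.1 (hS.subset hS.mem)).2
  rw [penalty, ← card_Icc_add_one hτT] at hmin
  have hmem : max τ τs ∈ S := by
    rcases max_choice τ τs with h | h <;> rw [h]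
    exacts [hτ, hS.mem]
  have hmT : max τ τs ≤ T := max_le hτT hτsT
  have hsub : Finset.Icc (max τ τs + 1) T ⊆ Finset.Icc (τ + 1) T :=
    Finset.Icc_subset_Icc_left (Nat.succ_le_succ (le_max_left _ _))
  have hrow : ∀ j, ∑ k, |(θ₁ - θ₂) j k| ≤ rowGap θ₁ θ₂ := fun j => by
    refine le_trans (le_of_eq ?_) (sum_row_le_rowGap θ₁ θ₂ j)
    simp only [Matrix.sub_apply, abs_sub_comm]
  refine abs_sum_phi_sub_le_of_contaminated (θ' := θ₁) (ϑ := paramAt θ₁ θ₂ τs)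
    (J := Finset.Icc (max τ τs + 1) T) (b := rowGap θ₁ θ₂) hB hT hL hc hρ₂ h₂ h₁ hsub ?_
    (fun t ht => paramAt_of_lt ?_) (fun t ht => paramAt_of_le ?_) hrow ?_
    (size_right hS hmem) (hx.score_right τ hτ) (hx.cov_right _ hmem (le_max_right _ _)) hmin
  · rw [Nat.card_Icc, Nat.card_Icc]
    have : T + 1 - (τ + 1) ≤ 2 * (T + 1 - (max τ τs + 1)) := by omega
    exact_mod_cast this
  · have := (Finset.mem_Icc.1 ht).1
    omega
  · simp only [Finset.mem_sdiff, Finset.mem_Icc] at ht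
    omega
  · rw [Finset.card_sdiff_of_subset hsub, Nat.cast_sub (Finset.card_le_card hsub),
      card_Icc_add_one hτT, card_Icc_add_one hmT]
    rcases le_or_gt τ τs with h | h
    · rw [max_eq_right h]
      refine le_trans (le_of_eq ?_) (hS.left τ hτ h).1
      ring
    · rw [max_eq_left h.le, sub_self, mul_zero]
      positivity

/-- Needed where a segment is mostly contaminated and the oracle inequality does not apply: there a
long lag forces `b`, and with it `κ`, to be small. -/
lemma signal_le [Nonempty 𝒳] (hB : ∀ u v, B u v = B v u) (h₁ : θ₁.IsSymm) (h₂ : θ₂.IsSymm) :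
    signal B₀ B θ₁ θ₂ ≤ 2 * sparsity (θ₂ - θ₁) * (fluct B₀ B * rowGap θ₁ θ₂) ^ 2 := by
  refine (min_le_right _ _).trans ((expect_phi_sub_le hB h₁ θ₂).trans ?_)
  simp only [mul_pow, ← Finset.mul_sum]
  have := mul_le_mul_of_nonneg_left (sum_row_sq_le_rowGap h₁ h₂) (sq_nonneg (fluct B₀ B))
  linarith

/-- The gap condition of the search domain bounds the signal accumulated at large lags. -/
lemma mul_lag_le {κ s g n m L : ℝ} (hs : 0 ≤ s) (hm : 0 < m) (hL : 0 < L) (hg : 0 ≤ g)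
    (hκ : κ ≤ 2 * s * g ^ 2) (hgm : g * m ≤ 2 * √(n * L)) (hn0 : 0 ≤ n) (hn : n ≤ 2 * m) :
    κ * m ≤ 16 * s * L := by
  have h1 : (g * m) ^ 2 ≤ 4 * (n * L) := by
    have := pow_le_pow_left₀ (mul_nonneg hg hm.le) hgm 2
    rw [mul_pow 2, Real.sq_sqrt (by positivity)] at this
    linarith
  have h2 : g ^ 2 * m ≤ 8 * L := by
    have h3 : n * L ≤ 2 * m * L := mul_le_mul_of_nonneg_right hn hL.le
    have : g ^ 2 * m * m ≤ 8 * L * m := by linarith [mul_pow g m 2, sq m]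
    exact le_of_mul_le_mul_right this hm
  calc κ * m ≤ 2 * s * g ^ 2 * m := mul_le_mul_of_nonneg_right hκ hm.le
    _ = 2 * s * (g ^ 2 * m) := by ring
    _ ≤ 2 * s * (8 * L) := mul_le_mul_of_nonneg_left h2 (by positivity)
    _ = 16 * s * L := by ring

lemma sum_Icc_one_eq_add {f : ℕ → ℝ} {a b : ℕ} (h : a ≤ b) :
    ∑ t ∈ Finset.Icc 1 b, f t = ∑ t ∈ Finset.Icc 1 a, f t + ∑ t ∈ Finset.Icc (a + 1) b, f t := by
  rw [← Finset.sum_union (Finset.disjoint_left.2 fun t h1 h2 => by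
    simp only [Finset.mem_Icc] at h1 h2; omega)]
  congr 1
  ext t
  simp only [Finset.mem_union, Finset.mem_Icc]
  omega

lemma sum_Icc_add_one_eq_add {f : ℕ → ℝ} {a b T : ℕ} (h : a ≤ b) (hb : b ≤ T) :
    ∑ t ∈ Finset.Icc (a + 1) T, f t
      = ∑ t ∈ Finset.Icc (a + 1) b, f t + ∑ t ∈ Finset.Icc (b + 1) T, f t := by
  rw [← Finset.sum_union (Finset.disjoint_left.2 fun t h1 h2 => by
    simp only [Finset.mem_Icc] at h1 h2; omega)]
  congr 1
  ext t
  simp only [Finset.mem_union, Finset.mem_Icc]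
  omega

/-- On typical data the change-point estimate is accurate. -/
lemma abs_estimate_sub_le [Nonempty 𝒳] {α δ : ℝ} {θ₁hat θ₂hat : ℕ → Matrix (Fin p) (Fin p) ℝ}
    {τhat : ℕ} (hB : ∀ u v, B u v = B v u) (hT : 0 < T)
    (hL : 0 < Real.log (dimn p * T)) (hc : 0 < fluct B₀ B) (h₁ : θ₁.IsSymm) (h₂ : θ₂.IsSymm)
    (hα : α * T ≤ τs) (hα' : (τs : ℝ) ≤ α * T + 1)
    (hρ₁ : RestrictedStrongConvexity B₀ B θ₁ ρ₁) (hρ₂ : RestrictedStrongConvexity B₀ B θ₂ ρ₂)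
    (hκ : κ = signal B₀ B θ₁ θ₂) (hκ0 : 0 < κ)
    (hδ : 30000 * (fluct B₀ B ^ 2 * (sparsity θ₁ / ρ₁) + fluct B₀ B ^ 2 * (sparsity θ₂ / ρ₂))
      * Real.log (dimn p * T) ≤ δ)
    (hδκ : 2 ≤ 4 * δ / κ)
    (hS : IsSearchDomain (fluct B₀ B) p T τs θ₁ θ₂ ρ₁ ρ₂ S)
    (hx : IsTypical B₀ B θ₁ θ₂ T τs ρ₁ ρ₂ (Real.log (dimn p * T)) κ (4 * δ / κ - 1) S x)
    (hest : IsChangePointEstimate B₀ B T S x θ₁hat θ₂hat τhat) :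
    |(τhat : ℝ) - α * T| ≤ 4 * δ / κ := by
  set L := Real.log (dimn p * T)
  set r₁ := fluct B₀ B ^ 2 * (sparsity θ₁ / ρ₁) with hr₁
  set r₂ := fluct B₀ B ^ 2 * (sparsity θ₂ / ρ₂) with hr₂
  set w := 4 * δ / κ with hw
  set s : ℝ := ((sparsity (θ₂ - θ₁) : ℕ) : ℝ) with hs
  have hκw : κ * w = 4 * δ := by rw [hw]; field_simp
  have hs0 : 0 ≤ s := Nat.cast_nonneg _
  have hsr : s ≤ r₁ + r₂ := by
    have : s ≤ sparsity θ₁ + sparsity θ₂ := by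
      rw [hs]
      exact_mod_cast sparsity_sub_le θ₁ θ₂
    linarith [sparsity_le hB hρ₁, sparsity_le hB hρ₂]
  have hr0 : 0 ≤ (r₁ + r₂) * L := mul_nonneg (hs0.trans hsr) hL.le
  have hsL : s * L ≤ (r₁ + r₂) * L := mul_le_mul_of_nonneg_right hsr hL.le
  have hκs := signal_le (B₀ := B₀) hB h₁ h₂
  rw [← hκ] at hκs
  have hg : 0 ≤ fluct B₀ B * rowGap θ₁ θ₂ := mul_nonneg hc.le (rowGap_nonneg _ _)
  have hT' : (0 : ℝ) < T := Nat.cast_pos.2 hT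
  obtain ⟨hτ1, hτT⟩ := Finset.mem_Icc.1 (hS.subset hest.mem)
  obtain ⟨hs1, hsT⟩ := Finset.mem_Icc.1 (hS.subset hS.mem)
  have o₁ := left_segment_oracle hB hT hL hc h₁ h₂ hρ₁ hS hx hS.mem (by omega)
    (hest.first τs hS.mem)
  have o₂ := right_segment_oracle hB hT hL hc h₁ h₂ hρ₂ hS hx hS.mem (by omega)
    (hest.second τs hS.mem)
  have hle := mul_le_mul_of_nonneg_left (hest.le τs hS.mem) hT'.le
  have e1 : ∀ a b : ℝ, T * (1 / T * a + 1 / T * b) = a + b := fun a b => by field_simp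
  simp only [pseudoLogLik, loss] at hle
  rw [e1, e1] at hle
  by_contra! hcon
  -- Two segments at each of two splits cost `2 * 13440 (r₁ + r₂) L`. A lag above `w - 1 ≥ w / 2`
  -- brings more than `κ w / 4 = δ ≥ 30000 (r₁ + r₂) L`, which explains the choice of `a`.
  have hfinal : ∀ m : ℝ, w - 1 < m → κ * m / 2 < 2 * (13440 * r₁ * L + 13440 * r₂ * L) → False := by
    intro m hm hlt
    have h1 : κ * (w - 1) < κ * m := mul_lt_mul_of_pos_left hm hκ0
    have h2 : κ * 2 ≤ κ * w := mul_le_mul_of_nonneg_left hδκ hκ0.le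
    linarith
  rcases lt_trichotomy τhat τs with h | h | h
  · have hR : (τhat : ℝ) + 1 ≤ τs := by exact_mod_cast h
    have hlag : w < (τs : ℝ) - τhat := by
      rcases lt_abs.1 hcon with h' | h' <;> linarith
    have hcast : ((τs - τhat : ℕ) : ℝ) = (τs : ℝ) - τhat := Nat.cast_sub h.le
    rcases le_or_gt (T - τhat) (2 * (T - τs)) with hhalf | hhalf
    · have o₃ := left_segment_oracle hB hT hL hc h₁ h₂ hρ₁ hS hx hest.mem (by omega)
        (hest.first τhat hest.mem)
      have o₄ := right_segment_oracle hB hT hL hc h₁ h₂ hρ₂ hS hx hest.mem hhalf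
        (hest.second τhat hest.mem)
      have hsig := hx.signal_left τhat hest.mem h (by rw [hcast]; linarith)
      rw [card_Icc_add_one h.le, Finset.sum_sub_distrib] at hsig
      have e2 := sum_Icc_one_eq_add (f := fun t => phi B₀ B θ₁ (x t)) h.le
      have e3 := sum_Icc_add_one_eq_add (f := fun t => phi B₀ B θ₂ (x t)) h.le hsT
      refine hfinal _ (by linarith : w - 1 < (τs : ℝ) - τhat) ?_
      linarith [(abs_le.1 o₁).2, (abs_le.1 o₂).2, (abs_le.1 o₃).1, (abs_le.1 o₄).1]
    -- The right segment is mostly contaminated: the lag exceeds half its length, so `κ` times the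
    -- lag is at most `16 s L`, well below `κ w = 4 δ`.
    · have hn : (T : ℝ) - τhat ≤ 2 * ((τs : ℝ) - τhat) := by
        have : T + τhat ≤ 2 * τs := by omega
        have : (T : ℝ) + τhat ≤ 2 * τs := by exact_mod_cast this
        linarith
      have hb := mul_lag_le hs0 (by linarith : 0 < (τs : ℝ) - τhat) hL hg hκs
        (hS.left τhat hest.mem h.le).1 (by rw [sub_nonneg]; exact_mod_cast hτT) hn
      have h1 : κ * w < κ * ((τs : ℝ) - τhat) := mul_lt_mul_of_pos_left hlag hκ0
      linarith
  · rw [h] at hcon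
    rcases lt_abs.1 hcon with h' | h' <;> linarith
  · have hR : (τs : ℝ) + 1 ≤ τhat := by exact_mod_cast h
    -- `τs` may exceed `α T` by up to one, so on this side a unit of lag is lost; hence the
    -- threshold `w - 1` in the typical event.
    have hlag : w - 1 < (τhat : ℝ) - τs := by
      rcases lt_abs.1 hcon with h' | h' <;> linarith
    have hcast : ((τhat - τs : ℕ) : ℝ) = (τhat : ℝ) - τs := Nat.cast_sub h.le
    rcases le_or_gt τhat (2 * τs) with hhalf | hhalf
    · have o₃ := left_segment_oracle hB hT hL hc h₁ h₂ hρ₁ hS hx hest.mem hhalf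
        (hest.first τhat hest.mem)
      have o₄ := right_segment_oracle hB hT hL hc h₁ h₂ hρ₂ hS hx hest.mem (by omega)
        (hest.second τhat hest.mem)
      have hsig := hx.signal_right τhat hest.mem h (by rw [hcast]; linarith)
      rw [card_Icc_add_one h.le, Finset.sum_sub_distrib] at hsig
      have e2 := sum_Icc_one_eq_add (f := fun t => phi B₀ B θ₁ (x t)) h.le
      have e3 := sum_Icc_add_one_eq_add (f := fun t => phi B₀ B θ₂ (x t)) h.le hτT
      refine hfinal _ hlag ?_
      linarith [(abs_le.1 o₁).2, (abs_le.1 o₂).2, (abs_le.1 o₃).1, (abs_le.1 o₄).1]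
    · have hn : (τhat : ℝ) ≤ 2 * ((τhat : ℝ) - τs) := by
        have : (2 : ℝ) * τs ≤ τhat := by exact_mod_cast hhalf.le
        linarith
      have hb := mul_lag_le hs0 (by linarith : 0 < (τhat : ℝ) - τs) hL hg hκs
        (hS.right τhat hest.mem h).1 (Nat.cast_nonneg _) hn
      have h1 : κ * w ≤ κ * (2 * ((τhat : ℝ) - τs)) :=
        mul_le_mul_of_nonneg_left (by linarith) hκ0.le
      nlinarith

end Segments

/-! ### Probability of atypical data -/

section Typical

variable {p : ℕ} {𝒳 : Type*} [Fintype 𝒳] {B₀ : 𝒳 → ℝ} {B : 𝒳 → 𝒳 → ℝ}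
  {θ₁ θ₂ : Matrix (Fin p) (Fin p) ℝ}

lemma abs_phi_sub_le_sqrt (hB : ∀ u v, B u v = B v u) (h₁ : θ₁.IsSymm) (h₂ : θ₂.IsSymm)
    (x : Fin p → 𝒳) :
    |phi B₀ B θ₂ x - phi B₀ B θ₁ x|
      ≤ 2 * fluct B₀ B * √(sparsity (θ₂ - θ₁) * normTwoSq (θ₂ - θ₁)) := by
  have hc := fluct_nonneg B₀ B
  have h := (sum_sum_abs_le (h₂.sub h₁)).trans
    (mul_le_mul_of_nonneg_left (Real.le_sqrt_of_sq_le (normOne_sq_le (θ₂ - θ₁))) zero_le_two)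
  refine (abs_phi_sub_le hB θ₁ θ₂ x).trans ((mul_le_mul_of_nonneg_left h hc).trans (le_of_eq ?_))
  ring

/-- Serves twice: it forces `c₀² s ‖θ₂ - θ₁‖₂²` to be positive when `κ` is, and it gives `q ≤ 1 /
32`, so that the asserted bound is trivial when `4δ/κ < 2`. -/
lemma signal_sq_le [Nonempty 𝒳] (hB : ∀ u v, B u v = B v u) (h₁ : θ₁.IsSymm) (h₂ : θ₂.IsSymm)
    (h0 : 0 ≤ signal B₀ B θ₁ θ₂) :
    signal B₀ B θ₁ θ₂ ^ 2
      ≤ 4 * (fluct B₀ B ^ 2 * sparsity (θ₂ - θ₁) * normTwoSq (θ₂ - θ₁)) := by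
  have h : signal B₀ B θ₁ θ₂ ≤ 2 * fluct B₀ B * √(sparsity (θ₂ - θ₁) * normTwoSq (θ₂ - θ₁)) :=
    (min_le_right _ _).trans
      (abs_le.1 (abs_expect_le fun x => abs_phi_sub_le_sqrt hB h₁ h₂ x)).2
  have h' := pow_le_pow_left₀ h0 h 2
  rw [mul_pow, mul_pow, Real.sq_sqrt (mul_nonneg (Nat.cast_nonneg _) (normTwoSq_nonneg _))] at h'
  linarith

variable [MeasurableSpace 𝒳] [MeasurableSingletonClass 𝒳] {Ω : Type*} [MeasurableSpace Ω]
  {μ : Measure Ω} [IsProbabilityMeasure μ] {T τs : ℕ} {X : ℕ → Ω → Fin p → 𝒳} {ρ₁ ρ₂ κ w q : ℝ}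
  {S : Finset ℕ}

/-- Four families of at most `T p³` concentration events contribute `4 / d` each; large lags on
either side of `τs` contribute one geometric series each. -/
lemma measure_not_isTypical_le (hM : IsSingleChangePointModel μ B₀ B θ₁ θ₂ T τs X)
    (hB : ∀ u v, B u v = B v u) (hp : 0 < p) (hT : 0 < T)
    (hL : 0 < Real.log (dimn p * T)) (hc : 0 < fluct B₀ B) (h₁ : θ₁.IsSymm) (h₂ : θ₂.IsSymm)
    (hρ₁ : 0 < ρ₁) (hρ₂ : 0 < ρ₂) (hκ : κ = signal B₀ B θ₁ θ₂) (hκ0 : 0 < κ)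
    (hS : IsSearchDomain (fluct B₀ B) p T τs θ₁ θ₂ ρ₁ ρ₂ S)
    (hq : q = κ ^ 2 / (2 ^ 7 * fluct B₀ B ^ 2 * sparsity (θ₂ - θ₁) * normTwoSq (θ₂ - θ₁)))
    (hq0 : 0 < q) (hw : 2 ≤ w) :
    μ.real {ω | ¬ IsTypical B₀ B θ₁ θ₂ T τs ρ₁ ρ₂ (Real.log (dimn p * T)) κ (w - 1) S
      fun t => X t ω} ≤ 16 / dimn p + 2 * (Real.exp (-(q * w)) / (1 - Real.exp (-q))) := by
  set L := Real.log (dimn p * T)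
  set v := 2 * fluct B₀ B * √(sparsity (θ₂ - θ₁) * normTwoSq (θ₂ - θ₁)) with hv
  have hv0 : 0 ≤ v := by positivity
  -- Since `v² = 4 c₀² s ‖θ₂ - θ₁‖₂²`, the Hoeffding exponent at lag `m` is `4 q m`; the surplus
  -- over `q m` is spent in `sum_exp_neg_le`.
  have hv2 : ∀ m : ℝ, κ ^ 2 * m / (8 * v ^ 2) = 4 * q * m := fun m => by
    rw [hv, mul_pow, Real.sq_sqrt (mul_nonneg (Nat.cast_nonneg _) (normTwoSq_nonneg _)), hq]
    ring
  have hSI : ∀ τ ∈ S, 1 ≤ τ ∧ τ ≤ T := fun τ hτ => Finset.mem_Icc.1 (hS.subset hτ)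
  have hST : S.card ≤ T := by
    simpa using Finset.card_le_card hS.subset
  have hleft : ∀ τ ∈ S, Finset.Icc 1 τ ⊆ Finset.Icc 1 T := fun τ hτ =>
    Finset.Icc_subset_Icc_right (hSI τ hτ).2
  have hright : ∀ τ, Finset.Icc (τ + 1) T ⊆ Finset.Icc 1 T := fun τ =>
    Finset.Icc_subset_Icc_left (by omega)
  let I₂ := S ×ˢ (Finset.univ : Finset (Fin p × Fin p))
  let I₃ := (S.filter (· ≤ τs)) ×ˢ (Finset.univ : Finset (Fin p × Fin p × Fin p))
  let I₄ := (S.filter (τs ≤ ·)) ×ˢ (Finset.univ : Finset (Fin p × Fin p × Fin p))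
  have hI₂ : I₂.card ≤ T * p ^ 3 := by
    simp only [I₂, Finset.card_product, Finset.card_univ, Fintype.card_prod, Fintype.card_fin]
    refine Nat.mul_le_mul hST ?_
    rw [pow_succ, sq]
    exact Nat.le_mul_of_pos_right _ hp
  have hcard : ∀ S' ⊆ S, (S' ×ˢ (Finset.univ : Finset (Fin p × Fin p × Fin p))).card
      ≤ T * p ^ 3 := fun S' hS' => by
    simp only [Finset.card_product, Finset.card_univ, Fintype.card_prod, Fintype.card_fin]
    refine Nat.mul_le_mul ((Finset.card_le_card hS').trans hST) (le_of_eq ?_)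
    ring
  have hI₃ : I₃.card ≤ T * p ^ 3 := hcard _ (Finset.filter_subset _ _)
  have hI₄ : I₄.card ≤ T * p ^ 3 := hcard _ (Finset.filter_subset _ _)
  let A₁ : ℕ × Fin p × Fin p → Set Ω := fun e =>
    {ω | 3 * (fluct B₀ B * √((Finset.Icc 1 e.1).card * L))
      < |∑ t ∈ Finset.Icc 1 e.1, (score B₀ B θ₁ e.2.1 e.2.2 (X t ω)
        - expect B₀ B (paramAt θ₁ θ₂ τs t) (score B₀ B θ₁ e.2.1 e.2.2))|}
  let A₂ : ℕ × Fin p × Fin p → Set Ω := fun e =>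
    {ω | 3 * (fluct B₀ B * √((Finset.Icc (e.1 + 1) T).card * L))
      < |∑ t ∈ Finset.Icc (e.1 + 1) T, (score B₀ B θ₂ e.2.1 e.2.2 (X t ω)
        - expect B₀ B (paramAt θ₁ θ₂ τs t) (score B₀ B θ₂ e.2.1 e.2.2))|}
  let A₃ : ℕ × Fin p × Fin p × Fin p → Set Ω := fun e =>
    {ω | ρ₁ * (Finset.Icc 1 e.1).card / 64 < sparsity θ₁ * |∑ t ∈ Finset.Icc 1 e.1,
      (condCov B₀ B θ₁ e.2.1 e.2.2.1 e.2.2.2 (X t ω)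
        - expect B₀ B (paramAt θ₁ θ₂ τs t) (condCov B₀ B θ₁ e.2.1 e.2.2.1 e.2.2.2))|}
  let A₄ : ℕ × Fin p × Fin p × Fin p → Set Ω := fun e =>
    {ω | ρ₂ * (Finset.Icc (e.1 + 1) T).card / 64 < sparsity θ₂ * |∑ t ∈ Finset.Icc (e.1 + 1) T,
      (condCov B₀ B θ₂ e.2.1 e.2.2.1 e.2.2.2 (X t ω)
        - expect B₀ B (paramAt θ₁ θ₂ τs t) (condCov B₀ B θ₂ e.2.1 e.2.2.1 e.2.2.2))|}
  let S₅ := S.filter fun τ => τs < τ ∧ w - 1 < ((τ - τs : ℕ) : ℝ)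
  let S₆ := S.filter fun τ => τ < τs ∧ w - 1 < ((τs - τ : ℕ) : ℝ)
  let A₅ : ℕ → Set Ω := fun τ =>
    {ω | ∑ t ∈ Finset.Icc (τs + 1) τ, (phi B₀ B θ₁ (X t ω) - phi B₀ B θ₂ (X t ω))
      ≤ κ * (Finset.Icc (τs + 1) τ).card / 2}
  let A₆ : ℕ → Set Ω := fun τ =>
    {ω | ∑ t ∈ Finset.Icc (τ + 1) τs, (phi B₀ B θ₂ (X t ω) - phi B₀ B θ₁ (X t ω))
      ≤ κ * (Finset.Icc (τ + 1) τs).card / 2}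
  have b₁ : μ.real (⋃ e ∈ I₂, A₁ e) ≤ 4 / dimn p :=
    (measure_biUnion_le_card_mul I₂ fun e he =>
      measure_score_le hM hB hc hL (hleft _ (Finset.mem_product.1 he).1) θ₁ e.2.1 e.2.2).trans
      (card_mul_exp_le hp hT hI₂)
  have b₂ : μ.real (⋃ e ∈ I₂, A₂ e) ≤ 4 / dimn p :=
    (measure_biUnion_le_card_mul I₂ fun e _ =>
      measure_score_le hM hB hc hL (hright _) θ₂ e.2.1 e.2.2).trans
      (card_mul_exp_le hp hT hI₂)
  have b₃ : μ.real (⋃ e ∈ I₃, A₃ e) ≤ 4 / dimn p :=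
    (measure_biUnion_le_card_mul _ fun e he => by
      have hτ := (Finset.mem_filter.1 (Finset.mem_product.1 he).1).1
      exact measure_condCov_le hM hB hc hL hρ₁ (hleft _ hτ) θ₁ (size_left hS hτ)
        e.2.1 e.2.2.1 e.2.2.2).trans (card_mul_exp_le hp hT hI₃)
  have b₄ : μ.real (⋃ e ∈ I₄, A₄ e) ≤ 4 / dimn p :=
    (measure_biUnion_le_card_mul _ fun e he => by
      have hτ := (Finset.mem_filter.1 (Finset.mem_product.1 he).1).1
      exact measure_condCov_le hM hB hc hL hρ₂ (hright _) θ₂ (size_right hS hτ)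
        e.2.1 e.2.2.1 e.2.2.2).trans (card_mul_exp_le hp hT hI₄)
  have b₅ : μ.real (⋃ τ ∈ S₅, A₅ τ) ≤ Real.exp (-(q * w)) / (1 - Real.exp (-q)) := by
    refine (measureReal_biUnion_finset_le _ _).trans (le_trans (Finset.sum_le_sum fun τ hτ => ?_)
      (sum_exp_neg_le (A := S₅) (f := fun τ => τ - τs) (fun a ha b hb hab => ?_) hq0 hw
        fun τ hτ => (Finset.mem_filter.1 hτ).2.2))
    · obtain ⟨hτS, hlt, -⟩ := Finset.mem_filter.1 hτ
      have := measure_sum_phi_sub_le hM (J := Finset.Icc (τs + 1) τ) (θ := θ₂) (θ' := θ₁) (κ := κ)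
        (Finset.Icc_subset_Icc (by omega) (hSI τ hτS).2)
        (fun t ht => paramAt_of_lt (Finset.mem_Icc.1 ht).1) hv0
        (fun x => by rw [abs_sub_comm]; exact abs_phi_sub_le_sqrt hB h₁ h₂ x) hκ0.le
        (hκ.le.trans (min_le_left _ _))
      refine this.trans (le_of_eq ?_)
      rw [hv2, card_Icc_add_one hlt.le, ← Nat.cast_sub hlt.le]
    · have ha := (Finset.mem_filter.1 ha).2.1
      have hb := (Finset.mem_filter.1 hb).2.1
      simp only at hab
      omega
  have b₆ : μ.real (⋃ τ ∈ S₆, A₆ τ) ≤ Real.exp (-(q * w)) / (1 - Real.exp (-q)) := by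
    refine (measureReal_biUnion_finset_le _ _).trans (le_trans (Finset.sum_le_sum fun τ hτ => ?_)
      (sum_exp_neg_le (A := S₆) (f := fun τ => τs - τ) (fun a ha b hb hab => ?_) hq0 hw
        fun τ hτ => (Finset.mem_filter.1 hτ).2.2))
    · obtain ⟨hτS, hlt, -⟩ := Finset.mem_filter.1 hτ
      have := measure_sum_phi_sub_le hM (J := Finset.Icc (τ + 1) τs) (θ := θ₁) (θ' := θ₂) (κ := κ)
        (Finset.Icc_subset_Icc (by omega) (hSI τs hS.mem).2)
        (fun t ht => paramAt_of_le (Finset.mem_Icc.1 ht).2) hv0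
        (fun x => abs_phi_sub_le_sqrt hB h₁ h₂ x) hκ0.le (hκ.le.trans (min_le_right _ _))
      refine this.trans (le_of_eq ?_)
      rw [hv2, card_Icc_add_one hlt.le, ← Nat.cast_sub hlt.le]
    · have ha := (Finset.mem_filter.1 ha).2.1
      have hb := (Finset.mem_filter.1 hb).2.1
      simp only at hab
      omega
  have hsub : {ω | ¬ IsTypical B₀ B θ₁ θ₂ T τs ρ₁ ρ₂ L κ (w - 1) S fun t => X t ω}
      ⊆ (⋃ e ∈ I₂, A₁ e) ∪ ((⋃ e ∈ I₂, A₂ e) ∪ ((⋃ e ∈ I₃, A₃ e)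
        ∪ ((⋃ e ∈ I₄, A₄ e) ∪ ((⋃ τ ∈ S₅, A₅ τ) ∪ ⋃ τ ∈ S₆, A₆ τ)))) := by
    intro ω hω
    by_contra hcon
    simp only [Set.mem_union, not_or, Set.mem_iUnion, not_exists] at hcon
    obtain ⟨c₁, c₂, c₃, c₄, c₅, c₆⟩ := hcon
    exact hω
      { score_left := fun τ hτ j k => not_lt.1
          (c₁ (τ, j, k) (Finset.mem_product.2 ⟨hτ, Finset.mem_univ _⟩))
        score_right := fun τ hτ j k => not_lt.1
          (c₂ (τ, j, k) (Finset.mem_product.2 ⟨hτ, Finset.mem_univ _⟩))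
        cov_left := fun τ hτ h i k l => not_lt.1 (c₃ (τ, i, k, l)
          (Finset.mem_product.2 ⟨Finset.mem_filter.2 ⟨hτ, h⟩, Finset.mem_univ _⟩))
        cov_right := fun τ hτ h i k l => not_lt.1 (c₄ (τ, i, k, l)
          (Finset.mem_product.2 ⟨Finset.mem_filter.2 ⟨hτ, h⟩, Finset.mem_univ _⟩))
        signal_right := fun τ hτ h h' => not_le.1 (c₅ τ (Finset.mem_filter.2 ⟨hτ, h, h'⟩))
        signal_left := fun τ hτ h h' => not_le.1 (c₆ τ (Finset.mem_filter.2 ⟨hτ, h, h'⟩)) }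
  refine (measureReal_mono hsub).trans ?_
  have u₁ := measureReal_union_le (μ := μ) (⋃ e ∈ I₂, A₁ e) ((⋃ e ∈ I₂, A₂ e)
    ∪ ((⋃ e ∈ I₃, A₃ e) ∪ ((⋃ e ∈ I₄, A₄ e)
      ∪ ((⋃ τ ∈ S₅, A₅ τ) ∪ ⋃ τ ∈ S₆, A₆ τ))))
  have u₂ := measureReal_union_le (μ := μ) (⋃ e ∈ I₂, A₂ e)
    ((⋃ e ∈ I₃, A₃ e) ∪ ((⋃ e ∈ I₄, A₄ e)
      ∪ ((⋃ τ ∈ S₅, A₅ τ) ∪ ⋃ τ ∈ S₆, A₆ τ)))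
  have u₃ := measureReal_union_le (μ := μ) (⋃ e ∈ I₃, A₃ e)
    ((⋃ e ∈ I₄, A₄ e) ∪ ((⋃ τ ∈ S₅, A₅ τ) ∪ ⋃ τ ∈ S₆, A₆ τ))
  have u₄ := measureReal_union_le (μ := μ) (⋃ e ∈ I₄, A₄ e)
    ((⋃ τ ∈ S₅, A₅ τ) ∪ ⋃ τ ∈ S₆, A₆ τ)
  have u₅ := measureReal_union_le (μ := μ) (⋃ τ ∈ S₅, A₅ τ) (⋃ τ ∈ S₆, A₆ τ)
  have e16 : 16 / dimn p = 4 / dimn p + 4 / dimn p + 4 / dimn p + 4 / dimn p := by ring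
  linarith

end Typical

/-- The probability bound is vacuous unless `4δ/κ ≥ 2`. -/
lemma one_le_bound {κ q w V d : ℝ} (hd : 0 ≤ d) (hκ : κ ^ 2 ≤ 4 * V) (hV : 0 < V)
    (hq : q = κ ^ 2 / (2 ^ 7 * V)) (hq0 : 0 < q) (hw : w < 2) :
    1 ≤ 16 / d + 4 * Real.exp (-(q * w)) / (1 - Real.exp (-q)) := by
  have hq1 : q ≤ 1 / 32 := by
    rw [hq, div_le_iff₀ (by positivity)]
    linarith
  have h1 : 15 / 16 ≤ Real.exp (-(q * w)) := by
    have := Real.add_one_le_exp (-(q * w))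
    nlinarith
  have h2 : 0 < 1 - Real.exp (-q) := sub_pos.2 (Real.exp_lt_one_iff.2 (by linarith))
  have h3 : 1 ≤ 4 * Real.exp (-(q * w)) / (1 - Real.exp (-q)) := by
    rw [le_div_iff₀ h2]
    linarith [Real.exp_pos (-q)]
  have : 0 ≤ 16 / d := by positivity
  linarith

end MRFChangePoint

/-! ### Proof of the theorem -/

theorem theorem1 :
    ∃ a : ℝ, 0 < a ∧
      ∀ {𝒳 : Type*} [Fintype 𝒳] [MeasurableSpace 𝒳] [MeasurableSingletonClass 𝒳]
        {Ω : Type*} [MeasurableSpace Ω] (μ : Measure Ω) [IsProbabilityMeasure μ]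
        (p T : ℕ) (B₀ : 𝒳 → ℝ) (B : 𝒳 → 𝒳 → ℝ)
        (θ₁ θ₂ : Matrix (Fin p) (Fin p) ℝ) (α ρ₁ ρ₂ : ℝ) (τs : ℕ)
        (X : ℕ → Ω → Fin p → 𝒳) (S : Finset ℕ)
        (θ₁hat θ₂hat : Ω → ℕ → Matrix (Fin p) (Fin p) ℝ) (τhat : Ω → ℕ) (c₀ κ δ s N : ℝ),
        c₀ = fluct B₀ B →
        κ = signal B₀ B θ₁ θ₂ →
        δ = a * mConst c₀ θ₁ θ₂ ρ₁ ρ₂ * c₀ ^ 2 * Real.log (dimn p * T) →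
        s = sparsity (θ₂ - θ₁) →
        N = normTwoSq (θ₂ - θ₁) →
        B₀ ≠ 0 → B ≠ 0 → (∀ u v, B u v = B v u) →
        θ₁.IsSymm → θ₂.IsSymm →
        -- the change-point and the observations
        0 < α → α < 1 → τs = ⌈α * T⌉₊ → 1 ≤ τs → τs < T →
        IsSingleChangePointModel μ B₀ B θ₁ θ₂ T τs X →
        -- restricted strong convexity
        RestrictedStrongConvexity B₀ B θ₁ ρ₁ → RestrictedStrongConvexity B₀ B θ₂ ρ₂ →
        -- sample size
        SampleSize c₀ p T α θ₁ θ₂ ρ₁ ρ₂ →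
        -- identifiability
        θ₁ ≠ θ₂ → 0 < κ →
        -- the search domain and the estimators
        IsSearchDomain c₀ p T τs θ₁ θ₂ ρ₁ ρ₂ S →
        (∀ ω, IsChangePointEstimate B₀ B T S (fun t => X t ω) (θ₁hat ω) (θ₂hat ω) (τhat ω)) →
        μ.real {ω | 4 * δ / (κ * T) < |(τhat ω : ℝ) / T - α|} ≤
          16 / dimn p +
            4 * Real.exp (-(δ / (32 * c₀ ^ 2 * s) * (κ / N))) /
              (1 - Real.exp (-(κ ^ 2 / (2 ^ 7 * c₀ ^ 2 * s * N)))) := by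

  refine ⟨30000, by norm_num, ?_⟩
  intro 𝒳 _ _ _ Ω _ μ _ p T B₀ B θ₁ θ₂ α ρ₁ ρ₂ τs X S θ₁hat θ₂hat τhat c₀ κ δ s N hc₀ hκ hδ hs hN
    hB₀ _ hB h₁ h₂ hα _ hτs hτs1 hτsT hM hρ₁ hρ₂ _ hne hκ0 hS hest
  subst hc₀ hs hN
  set c := fluct B₀ B with hc
  obtain ⟨u, -⟩ := Function.ne_iff.1 hB₀
  have : Nonempty 𝒳 := ⟨u⟩
  have hp : 0 < p := by
    refine Nat.pos_of_ne_zero fun h => hne ?_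
    subst h
    ext i
    exact i.elim0
  have hT : 0 < T := by omega
  have hT' : (0 : ℝ) < T := Nat.cast_pos.2 hT
  have hd := one_le_dimn hp
  have hL : 0 < Real.log (dimn p * T) := by
    refine Real.log_pos ?_
    have : (2 : ℝ) ≤ T := by exact_mod_cast (by omega : 2 ≤ T)
    nlinarith
  have hVsq : κ ^ 2 ≤ 4 * (c ^ 2 * sparsity (θ₂ - θ₁) * normTwoSq (θ₂ - θ₁)) := by
    rw [hκ]
    exact signal_sq_le hB h₁ h₂ (hκ ▸ hκ0.le)
  have hV : 0 < c ^ 2 * sparsity (θ₂ - θ₁) * normTwoSq (θ₂ - θ₁) := by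
    have := pow_pos hκ0 2
    linarith
  have hcpos : 0 < c := by
    refine (fluct_nonneg B₀ B).lt_of_ne fun h => ?_
    rw [hc, ← h] at hV
    simp at hV
  set q := κ ^ 2 / (2 ^ 7 * c ^ 2 * sparsity (θ₂ - θ₁) * normTwoSq (θ₂ - θ₁)) with hq
  have hq' : q = κ ^ 2 / (2 ^ 7 * (c ^ 2 * sparsity (θ₂ - θ₁) * normTwoSq (θ₂ - θ₁))) := by
    rw [hq]; ring
  have hq0 : 0 < q := by rw [hq']; positivity
  set w := 4 * δ / κ with hw
  have hqw : δ / (32 * c ^ 2 * sparsity (θ₂ - θ₁)) * (κ / normTwoSq (θ₂ - θ₁)) = q * w := by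
    have hNpos := normTwoSq_sub_pos h₁ h₂ hne
    have hspos : (sparsity (θ₂ - θ₁) : ℝ) ≠ 0 := fun h => by simp [h] at hV
    rw [hq, hw]
    field_simp
    ring
  rw [hqw]
  -- For `w < 2` the right-hand side is at least one; for `w ≥ 2` the unit lost to rounding at most
  -- halves `w`.
  rcases lt_or_ge w 2 with hw2 | hw2
  · exact measureReal_le_one.trans (one_le_bound (by linarith) hVsq hV hq' hq0 hw2)
  have hαT : 0 ≤ α * T := by positivity
  have hle1 : α * T ≤ τs := hτs ▸ Nat.le_ceil _
  have hle2 : (τs : ℝ) ≤ α * T + 1 := hτs ▸ (Nat.ceil_lt_add_one hαT).le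
  have hδ' : 30000 * (c ^ 2 * (sparsity θ₁ / ρ₁) + c ^ 2 * (sparsity θ₂ / ρ₂))
      * Real.log (dimn p * T) ≤ δ := by
    have hr₁ : 0 ≤ sparsity θ₁ / ρ₁ := div_nonneg (Nat.cast_nonneg _) hρ₁.1.le
    have hr₂ : 0 ≤ sparsity θ₂ / ρ₂ := div_nonneg (Nat.cast_nonneg _) hρ₂.1.le
    -- The terms of `M` linear in `sᵢ / ρᵢ` suffice: multiplied by `c₀²` they are `r₁ + r₂`.
    have hM' : sparsity θ₁ / ρ₁ + sparsity θ₂ / ρ₂ ≤ mConst c θ₁ θ₂ ρ₁ ρ₂ := by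
      unfold mConst
      have := mul_nonneg hcpos.le (mul_self_nonneg (sparsity θ₁ / ρ₁))
      have := mul_nonneg hcpos.le (mul_self_nonneg (sparsity θ₂ / ρ₂))
      linarith
    have := mul_le_mul_of_nonneg_right hM' (by positivity : 0 ≤ c ^ 2 * Real.log (dimn p * T))
    rw [hδ]
    linarith
  refine (measureReal_mono (μ := μ) (s₂ := {ω | ¬ IsTypical B₀ B θ₁ θ₂ T τs ρ₁ ρ₂ (Real.log (dimn p * T)) κ
    (w - 1) S fun t => X t ω}) fun ω hω htyp => ?_).trans
    ((measure_not_isTypical_le hM hB hp hT hL hcpos h₁ h₂ hρ₁.1 hρ₂.1 hκ hκ0 hS hq hq0 hw2).trans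
      ?_)
  · have h := abs_estimate_sub_le hB hT hL hcpos h₁ h₂ hle1 hle2 hρ₁ hρ₂ hκ hκ0 hδ' hw2 hS htyp
      (hest ω)
    have hω : 4 * δ / (κ * T) < |(τhat ω : ℝ) / T - α| := hω
    refine absurd hω (not_lt.2 ?_)
    have e : (τhat ω : ℝ) / T - α = ((τhat ω : ℝ) - α * T) / T := by field_simp
    rw [e, abs_div, abs_of_pos hT', ← div_div]
    exact div_le_div_of_nonneg_right h hT'.le
  · have h2 : 0 < 1 - Real.exp (-q) := sub_pos.2 (Real.exp_lt_one_iff.2 (by linarith))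
    have : 0 ≤ Real.exp (-(q * w)) / (1 - Real.exp (-q)) := div_nonneg (Real.exp_pos _).le h2.le
    rw [mul_div_assoc]
    linarith
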